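/- Let $d\ge 1$, let $\mathbb{P}^{N_d}$ be the projective space of nonzero forms $F_a(Z)=\sum_{|\alpha|=d}a_\alpha Z^\alpha$ of degree $d$ in $Z=(Z_0,\dots,Z_3)$ over $\mathbb{C}$, up to scalars, and let $\mathcal{X}=\{F_a(Z)=0\}\subset\mathbb{P}^3\times\mathbb{P}^{N_d}$ be the universal surface of degree $d$. Let $\overline{J_3^v}(\mathbb{P}^3\times\mathbb{P}^{N_d})$ be the space of logarithmic 3-jets of the log-manifold $(\mathbb{P}^3\times\mathbb{P}^{N_d},\mathcal{X})$ that are tangent to the fibres of the projection to $\mathbb{P}^{N_d}$. Its points are the vertical 3-jets of curves $t\mapsto(Z(t),a)$ together with $\eta(t)$ modulo $t^3$ such that $s'(t)\equiv\eta(t)s(t)$ modulo $t^3$, where $s(t)$ is a local equation of $\mathcal{X}$ evaluated along the curve. Let $U\subset\mathbb{P}^{N_d+1}$ be the set of all $[a:a_d]$ with $a_d\ne0$ and $a\neq 0$, let $\mathcal{Y}=\{a_dZ_4^d+F_a(Z_0,\dots,Z_3)=0\}\subset\mathbb{P}^4\times U$, let $H=\{Z_4=0\}\subset\mathcal{Y}$,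 and let $\pi_3:\overline{J_3^v}(\mathcal{Y})\to\overline{J_3^v}(\mathbb{P}^3\times\mathbb{P}^{N_d})$ be the map induced on vertical logarithmic 3-jets by the projection $(\mathcal{Y},H)\to(\mathbb{P}^3\times\mathbb{P}^{N_d},\mathcal{X})$. Let $\Sigma\subset\overline{J_3^v}(\mathcal{Y})$ be the closure of the set of jets over $\{Z_0\neq0\}$ with $\det(\xi_i^{(j)})_{1\le i,j\le3}=0$, where $\xi_i^{(j)}$ is the $j$-th derivative at $t=0$ of the affine coordinate $z_i=Z_i/Z_0$ along the jet. Then there is an integer $m\ge0$ such that $$T_{\overline{J_3^v}(\mathbb{P}^3\times\mathbb{P}^{N_d})}\otimes\mathcal{O}_{\mathbb{P}^3}(12)\otimes\mathcal{O}_{\mathbb{P}^{N_d}}(m)$$ (the line bundles being pulled back to the jet space) is generated by its global holomorphic sections at every point of $\overline{J_3^v}(\mathbb{P}^3\times\mathbb{P}^{N_d})$ that lies neither in $\pi_3(\Sigma)$ nor over $\mathcal{X}$; that is, at such a point every vector of the fibre is the value of a global holomorphic section over the whole jet space. Equivalently, the tangent bundle is generated there by global meromorphic vector fields with poles of order at most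 $12$ along the preimage of a hyperplane of $\mathbb{P}^3$ and at most $m$ along the preimage of a hyperplane of $\mathbb{P}^{N_d}$. -/

import Mathlib

open Topology

noncomputable section

/-- Exponents `α ∈ ℕ⁴` with `|α| = d`.  They index the homogeneous coordinates `a_α` of `ℙ^{N_d}`,
the space of forms of degree `d` in four variables. -/
abbrev Expo (d : ℕ) : Type := {α : Fin 4 → ℕ // α ∈ Finset.Nat.antidiagonalTuple 4 d}

/-- The universal form `F_a(w) = ∑_{|α| = d} a_α w^α`, evaluated at a point `w ∈ R⁴` of any
commutative `ℂ`-algebra (points: `R = ℂ`; curves: `R = ℂ⟦t⟧`). -/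
def universalForm {d : ℕ} {R : Type*} [CommRing R] [Algebra ℂ R] (a : Expo d → ℂ)
    (w : Fin 4 → R) : R :=
  ∑ α : Expo d, algebraMap ℂ R (a α) * ∏ i, w i ^ (α.1 i)

/-- The series `c₀ + c₁ t + ⋯ + c_{n-1} t^{n-1}`. -/
def toSeries {n : ℕ} (c : Fin n → ℂ) : PowerSeries ℂ :=
  ∑ k : Fin n, PowerSeries.monomial (k : ℕ) (c k)

/-- A 3-jet of a curve in `ℂ^ι` is given by its Taylor coefficients `z k i` (`k` is the order, `i`
the coordinate); this is the series `Z_i(t) = ∑_{k ≤ 3} z k i t^k` of the `i`-th coordinate. -/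
def coordSeries {ι : Type*} (z : Fin 4 → ι → ℂ) (i : ι) : PowerSeries ℂ :=
  toSeries fun k => z k i

/-- For a local equation `s` of the boundary divisor, the logarithmic form `ds/s` sends a curve to
`η(t) dt` with `s' = η s`.  A logarithmic 3-jet is a 3-jet together with `η(t) mod t³` subject to
`s' ≡ η s (mod t³)`: when `s` is one of the coordinates, its jet is determined by `s(0)` and `η`,
and `η` is the fibre coordinate belonging to `ds/s`.  These are the coefficients of `s' - η s`. -/
def logDefect (s : PowerSeries ℂ) (η : Fin 3 → ℂ) (k : Fin 3) : ℂ :=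
  PowerSeries.coeff (k : ℕ) (PowerSeries.derivative ℂ s - toSeries η * s)

/-! ### The vertical logarithmic 3-jets of `(ℙ³ × ℙ^{N_d}, 𝒳)` -/

/-- Triples `(Z, a, η)`: a 3-jet `Z` of curves in `ℂ⁴`, a vector `a` of coefficients, and the first
three Taylor coefficients `η` of a logarithmic derivative. -/
abbrev JetCoords (d : ℕ) : Type := (Fin 4 → Fin 4 → ℂ) × (Expo d → ℂ) × (Fin 3 → ℂ)

/-- The equations of the vertical logarithmic jets: `η` is the logarithmic derivative of
`t ↦ F_a(Z(t))`, with `a` constant. -/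
def jetEquations (d : ℕ) (x : JetCoords d) : Fin 3 → ℂ :=
  logDefect (universalForm x.2.1 (coordSeries x.1)) x.2.2

/-- Homogeneous coordinates `(Z, a, η)` of the points of the vertical logarithmic 3-jet space of
`(ℙ³ × ℙ^{N_d}, 𝒳)`, `𝒳 = {F_a(Z) = 0}`.  Two triples give the same point if and only if they are
related by `(Z, a, η) ↦ (λ Z, μ a, η + d λ'/λ)` with `λ` a unit of `ℂ[t]/(t⁴)` and `μ ∈ ℂˣ`. -/
def jetCone (d : ℕ) : Set (JetCoords d) :=
  {x | x.1 0 ≠ 0 ∧ x.2.1 ≠ 0 ∧ jetEquations d x = 0}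

/-- The chart `{Z_i ≠ 0} × {a_β ≠ 0}` of the jet space: the coordinates are normalised by
`Z_i(t) = 1` and `a_β = 1`, so that `Z_l(t)` is the jet of the affine coordinate `Z_l / Z_i`, and `η`
belongs to `ds/s` for the local equation `s = F_a / (a_β Z_i^d)` of `𝒳`. -/
def jetChart (d : ℕ) (i : Fin 4) (β : Expo d) : Set (JetCoords d) :=
  {x | x ∈ jetCone d ∧ (∀ k, x.1 k i = if k = 0 then 1 else 0) ∧ x.2.1 β = 1}

/-- The change of charts into the chart `(i, β)`:
`(Z, a, η) ↦ (Z / Z_i, a / a_β, η - d Z_i' / Z_i)`. -/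
def toJetChart (d : ℕ) (i : Fin 4) (β : Expo d) (x : JetCoords d) : JetCoords d :=
  (fun k l => PowerSeries.coeff (k : ℕ) (coordSeries x.1 l * (coordSeries x.1 i)⁻¹),
   fun α => x.2.1 α / x.2.1 β,
   fun k => x.2.2 k - d * PowerSeries.coeff (k : ℕ)
     (PowerSeries.derivative ℂ (coordSeries x.1 i) * (coordSeries x.1 i)⁻¹))

/-- The tangent space of the jet space at the point `x` of the chart `(i, β)`: the vectors that
respect the normalisation and are killed by the differentials of the equations. -/
def jetTangentSpace (d : ℕ) (i : Fin 4) (β : Expo d) (x : JetCoords d) :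
    Submodule ℂ (JetCoords d) where
  carrier := {v | (∀ k, v.1 k i = 0) ∧ v.2.1 β = 0 ∧ fderiv ℂ (jetEquations d) x v = 0}
  add_mem' := by
    rintro v w ⟨h1, h2, h3⟩ ⟨g1, g2, g3⟩
    refine ⟨fun k => ?_, ?_, ?_⟩
    · simp [h1 k, g1 k]
    · simp [h2, g2]
    · rw [map_add, h3, g3, add_zero]
  zero_mem' := ⟨fun _ => rfl, rfl, map_zero _⟩
  smul_mem' := by
    rintro c v ⟨h1, h2, h3⟩
    refine ⟨fun k => ?_, ?_, ?_⟩
    · simp [h1 k]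
    · simp [h2]
    · rw [map_smul, h3, smul_zero]

/-- Global holomorphic sections of `T ⊗ 𝒪_{ℙ³}(c) ⊗ 𝒪_{ℙ^{N_d}}(m)`, where `T` is the tangent bundle
of the vertical logarithmic 3-jet space and the line bundles are pulled back to it.  In the chart
`(i, β)` the line bundle is trivialised by `Z_i^c a_β^m`, and a section is there a holomorphic
vector field `field i β` (locally the restriction of a holomorphic map of the surrounding vector
space); in an overlap the fields differ by the differential of the change of charts and by the
transition function of the line bundle. -/
structure TwistedJetField (d c m : ℕ) where
  field : Fin 4 → Expo d → JetCoords d → JetCoords d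
  holomorphic : ∀ i β, ∀ x ∈ jetChart d i β, ∃ V : JetCoords d → JetCoords d,
    AnalyticAt ℂ V x ∧ ∀ᶠ y in 𝓝[jetChart d i β] x, field i β y = V y
  tangent : ∀ i β, ∀ x ∈ jetChart d i β, field i β x ∈ jetTangentSpace d i β x
  compatible : ∀ i β j γ, ∀ x ∈ jetChart d i β, x.1 0 j ≠ 0 → x.2.1 γ ≠ 0 →
    field j γ (toJetChart d j γ x) =
      (x.1 0 j ^ c * x.2.1 γ ^ m)⁻¹ • fderiv ℂ (toJetChart d j γ) x (field i β x)

/-- The part of the jet space lying over `𝒳`. -/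
def overSurface (d : ℕ) : Set (JetCoords d) :=
  {x | universalForm x.2.1 (x.1 0) = 0}

/-! ### The covering `𝒴` and the locus `π₃(Σ)` -/

/-- Tuples `(Z, (a, a_d), ζ)`: a 3-jet `Z` of curves in `ℂ⁵`, coefficients `a` and `a_d`, and the
first three Taylor coefficients `ζ` of a logarithmic derivative. -/
abbrev CoverCoords (d : ℕ) : Type :=
  (Fin 4 → Fin 5 → ℂ) × ((Expo d → ℂ) × ℂ) × (Fin 3 → ℂ)

/-- Homogeneous coordinates of the vertical logarithmic 3-jets of `(𝒴, H)`, where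
`𝒴 = {a_d Z₄^d + F_a(Z₀, …, Z₃) = 0} ⊆ ℙ⁴ × {a_d ≠ 0, a ≠ 0}` and `H = {Z₄ = 0}`: the jet lies in
`𝒴` and `ζ` is the logarithmic derivative of `Z₄(t)`. -/
def coverCone (d : ℕ) : Set (CoverCoords d) :=
  {y | y.1 0 ≠ 0 ∧ y.2.1.1 ≠ 0 ∧ y.2.1.2 ≠ 0 ∧
    (∀ k : Fin 4, PowerSeries.coeff (k : ℕ)
      (PowerSeries.C y.2.1.2 * coordSeries y.1 4 ^ d
        + universalForm y.2.1.1 (fun i : Fin 4 => coordSeries y.1 i.castSucc)) = 0) ∧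
    logDefect (coordSeries y.1 4) y.2.2 = 0}

/-- `ξ_i^{(j)}`: the `j`-th derivative at `t = 0` of the affine coordinate `z_i = Z_i / Z₀`. -/
def affineDeriv (z : Fin 4 → Fin 5 → ℂ) (i : Fin 5) (j : ℕ) : ℂ :=
  (j.factorial : ℂ) * PowerSeries.coeff j (coordSeries z i * (coordSeries z 0)⁻¹)

/-- `Σ₀`: over `{Z₀ ≠ 0}`, the locus `det (ξ_i^{(j)})_{1 ≤ i, j ≤ 3} = 0`. -/
def wronskianLocus (d : ℕ) : Set (CoverCoords d) :=
  {y | y ∈ coverCone d ∧ y.1 0 0 ≠ 0 ∧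
    Matrix.det (Matrix.of fun i j : Fin 3 =>
      affineDeriv y.1 (i.castSucc.succ) ((j : ℕ) + 1)) = 0}

/-- `Σ`: the closure of `Σ₀` in the space of vertical logarithmic jets of `(𝒴, H)` (the space is the
quotient of `coverCone d` by a continuous group action, so the closure may be taken upstairs). -/
def sigmaLocus (d : ℕ) : Set (CoverCoords d) :=
  closure (wronskianLocus d) ∩ coverCone d

/-- The map `π₃` on vertical logarithmic jets induced by `π : 𝒴 → ℙ³ × ℙ^{N_d}`.  As
`F_a = - a_d Z₄^d` on `𝒴`, the logarithmic derivative of `F_a` is `d` times that of `Z₄`. -/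
def piThree (d : ℕ) (y : CoverCoords d) : JetCoords d :=
  (fun k i => y.1 k i.castSucc, y.2.1.1, fun k => d * y.2.2 k)

end

/-! A point of the jet space is a triple `(Z, a, η)` up to the group `(Z, a, η) ↦ (λ Z, μ a, η + d
λ'/λ)`. A vector field in these coordinates that is tangent to the equations and scales with weight
`λ(0)^c μ^m` descends: its images under the differentials of the chart normalisations form a section
twisted by `(c, m)` (`IsHomogeneousField.toTwisted`). Hence it suffices to find enough fields of
weight `(12, 0)`.

Two families are enough. A matrix `A` moves `Z` by `A Z` and `F_a` contragrediently, so `F_a(Z(t))`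
does not change and `η` may stay fixed; a factor `Z_i^12` gives the weight (`linearField`). The
other fields move only `a`, in directions of forms that vanish modulo `t⁴` along the jet. Cramer's
rule solves `∑ L_c Z_c Z_i ≡ det · Z_a Z_b`, so `Q (det · X_a X_b - X_i ∑ L_c X_c)` is such a form;
`det` and `L` have weight `λ(0)^8`, and the factor `Z_i^4 a_β` completes the weight to `(12, 0)`
(`cramerField`).

Let the Taylor coefficients of `Z` form an invertible matrix and let `s = F_a(Z(t))` be a unit. An
infinitesimal change of `λ`, invisible in the chart, removes from a tangent vector both its `η`-part
and its variation of `s` (`exists_homogeneousField`). A suitable `A` then matches the `Z`-part, and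
a form vanishing modulo `t⁴` along the jet is left. Modulo Cramer forms it reduces to `X_i^(d-1)`
times a linear form (`mem_attainedForms_sup`), and a linear form vanishing along a nondegenerate jet
is zero.

If the matrix is singular and `s` is a unit, a `d`-th root of `-s` lifts the jet to `𝒴`. A linear
relation among the `Z_l` makes the affine Wronskian vanish when `Z₀(0) ≠ 0`; otherwise a shear
exhibits the lift as a limit of such jets. So the degenerate jets off `𝒳` lie in `π₃(Σ)`
(`mem_piThree_sigmaLocus`). -/

noncomputable section

/-! ### Truncated power series -/

/-- Two power series agree modulo `t^n`. -/
def TruncEq (n : ℕ) (f g : PowerSeries ℂ) : Prop :=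
  ∀ k < n, PowerSeries.coeff k f = PowerSeries.coeff k g

namespace TruncEq

variable {n : ℕ} {f g h f' g' : PowerSeries ℂ}

theorem refl (n : ℕ) (f : PowerSeries ℂ) : TruncEq n f f := fun _ _ => rfl

theorem symm (H : TruncEq n f g) : TruncEq n g f := fun k hk => (H k hk).symm

theorem trans (H : TruncEq n f g) (H' : TruncEq n g h) : TruncEq n f h :=
  fun k hk => (H k hk).trans (H' k hk)

theorem add (H : TruncEq n f g) (H' : TruncEq n f' g') : TruncEq n (f + f') (g + g') :=
  fun k hk => by rw [map_add, map_add, H k hk, H' k hk]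

theorem sub (H : TruncEq n f g) (H' : TruncEq n f' g') : TruncEq n (f - f') (g - g') :=
  fun k hk => by rw [map_sub, map_sub, H k hk, H' k hk]

theorem mul (H : TruncEq n f g) (H' : TruncEq n f' g') : TruncEq n (f * f') (g * g') := by
  intro k hk
  rw [PowerSeries.coeff_mul, PowerSeries.coeff_mul]
  refine Finset.sum_congr rfl fun p hp => ?_
  have := Finset.HasAntidiagonal.mem_antidiagonal.mp hp
  rw [H _ (by omega), H' _ (by omega)]

theorem pow (H : TruncEq n f g) (m : ℕ) : TruncEq n (f ^ m) (g ^ m) := by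
  induction m with
  | zero => simpa using refl n 1
  | succ m ih => simpa only [pow_succ] using ih.mul H

theorem sum {ι : Type*} {s : Finset ι} {u v : ι → PowerSeries ℂ}
    (H : ∀ i ∈ s, TruncEq n (u i) (v i)) : TruncEq n (∑ i ∈ s, u i) (∑ i ∈ s, v i) :=
  fun k hk => by
    rw [map_sum, map_sum]; exact Finset.sum_congr rfl fun i hi => H i hi k hk

theorem mono {m : ℕ} (H : TruncEq n f g) (hm : m ≤ n) : TruncEq m f g :=
  fun k hk => H k (hk.trans_le hm)

theorem derivative (H : TruncEq (n + 1) f g) :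
    TruncEq n (PowerSeries.derivative ℂ f) (PowerSeries.derivative ℂ g) :=
  fun k hk => by
    rw [PowerSeries.coeff_derivative, PowerSeries.coeff_derivative, H _ (by omega)]

theorem aeval {σ : Type*} {u v : σ → PowerSeries ℂ} (H : ∀ i, TruncEq n (u i) (v i))
    (P : MvPolynomial σ ℂ) : TruncEq n (MvPolynomial.aeval u P) (MvPolynomial.aeval v P) := by
  induction P using MvPolynomial.induction_on with
  | C c => simpa using refl n _
  | add p q hp hq => simpa only [map_add] using hp.add hq
  | mul_X p i hp => simpa only [map_mul, MvPolynomial.aeval_X] using hp.mul (H i)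

theorem cancel_left (hf : PowerSeries.constantCoeff f ≠ 0) (H : TruncEq n (f * g) (f * h)) :
    TruncEq n g h := by
  have := (refl n f⁻¹).mul H
  rwa [← mul_assoc, ← mul_assoc, PowerSeries.inv_mul_cancel _ hf, one_mul, one_mul] at this

theorem inv (hf : PowerSeries.constantCoeff f ≠ 0) (H : TruncEq n f g) :
    TruncEq n f⁻¹ g⁻¹ := by
  rcases Nat.eq_zero_or_pos n with rfl | hn
  · exact fun k hk => absurd hk (Nat.not_lt_zero _)
  have hg : PowerSeries.constantCoeff g ≠ 0 := by
    have := H 0 hn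
    simp only [PowerSeries.coeff_zero_eq_constantCoeff] at this
    rwa [← this]
  refine cancel_left hf ?_
  rw [PowerSeries.mul_inv_cancel _ hf, ← PowerSeries.mul_inv_cancel _ hg]
  exact H.symm.mul (refl n _)

end TruncEq

theorem coeff_toSeries {n : ℕ} (c : Fin n → ℂ) (k : Fin n) :
    PowerSeries.coeff (k : ℕ) (toSeries c) = c k := by
  rw [toSeries, map_sum, Finset.sum_eq_single k]
  · simp
  · intro j _ hj
    rw [PowerSeries.coeff_monomial, if_neg]
    exact fun h => hj (Fin.ext h.symm)
  · simp

theorem toSeries_add {n : ℕ} (c c' : Fin n → ℂ) : toSeries (c + c') = toSeries c + toSeries c' := by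
  simp [toSeries, Finset.sum_add_distrib]

theorem toSeries_smul {n : ℕ} (r : ℂ) (c : Fin n → ℂ) : toSeries (r • c) = r • toSeries c := by
  simp only [toSeries, Finset.smul_sum, Pi.smul_apply, map_smul]

theorem truncEq_toSeries {n : ℕ} (f : PowerSeries ℂ) :
    TruncEq n (toSeries fun k : Fin n => PowerSeries.coeff (k : ℕ) f) f :=
  fun k hk => coeff_toSeries (fun k : Fin n => PowerSeries.coeff (k : ℕ) f) ⟨k, hk⟩

theorem coeff_coordSeries {ι : Type*} (z : Fin 4 → ι → ℂ) (i : ι) (k : Fin 4) :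
    PowerSeries.coeff (k : ℕ) (coordSeries z i) = z k i :=
  coeff_toSeries (fun k => z k i) k

theorem constantCoeff_coordSeries {ι : Type*} (z : Fin 4 → ι → ℂ) (i : ι) :
    PowerSeries.constantCoeff (coordSeries z i) = z 0 i := by
  simpa using coeff_coordSeries z i 0

theorem truncEq_coordSeries {ι : Type*} (w : ι → PowerSeries ℂ) (i : ι) :
    TruncEq 4 (coordSeries (fun k l => PowerSeries.coeff (k : ℕ) (w l)) i) (w i) :=
  truncEq_toSeries (w i)

theorem coordSeries_add {ι : Type*} (z w : Fin 4 → ι → ℂ) (i : ι) :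
    coordSeries (z + w) i = coordSeries z i + coordSeries w i := toSeries_add _ _

theorem coordSeries_smul {ι : Type*} (c : ℂ) (z : Fin 4 → ι → ℂ) (i : ι) :
    coordSeries (c • z) i = c • coordSeries z i := toSeries_smul c _

/-! ### Forms of degree `d` and their coefficients -/

/-- The polynomial `∑ a_α X^α`. -/
def formPoly {d : ℕ} (a : Expo d → ℂ) : MvPolynomial (Fin 4) ℂ :=
  ∑ α : Expo d, MvPolynomial.monomial (Finsupp.equivFunOnFinite.symm α.1) (a α)

/-- The coefficients of the degree `d` part of a polynomial. -/
def formCoeffs (d : ℕ) : MvPolynomial (Fin 4) ℂ →ₗ[ℂ] (Expo d → ℂ) where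
  toFun P α := P.coeff (Finsupp.equivFunOnFinite.symm α.1)
  map_add' _ _ := by ext; simp
  map_smul' _ _ := by ext; simp

section Forms

variable {d : ℕ} {R : Type*} [CommRing R] [Algebra ℂ R]

theorem aeval_formPoly (a : Expo d → ℂ) (w : Fin 4 → R) :
    MvPolynomial.aeval w (formPoly a) = universalForm a w := by
  simp [formPoly, universalForm, MvPolynomial.aeval_monomial, Finsupp.prod_fintype]

theorem formPoly_add (a b : Expo d → ℂ) : formPoly (a + b) = formPoly a + formPoly b := by
  simp [formPoly, Finset.sum_add_distrib]

theorem formPoly_smul (c : ℂ) (a : Expo d → ℂ) : formPoly (c • a) = c • formPoly a := by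
  simp [formPoly, Finset.smul_sum, MvPolynomial.smul_monomial]

theorem formPoly_isHomogeneous (a : Expo d → ℂ) : (formPoly a).IsHomogeneous d := by
  refine MvPolynomial.IsHomogeneous.sum _ _ _ fun α _ => ?_
  apply MvPolynomial.isHomogeneous_monomial
  rw [Finsupp.degree_eq_sum]
  simpa using Finset.Nat.mem_antidiagonalTuple.mp α.2

theorem formPoly_formCoeffs {P : MvPolynomial (Fin 4) ℂ} (hP : P.IsHomogeneous d) :
    formPoly (formCoeffs d P) = P := by
  ext m
  rw [formPoly, MvPolynomial.coeff_sum]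
  simp only [MvPolynomial.coeff_monomial]
  by_cases hm : m.degree = d
  · have hm' : ⇑m ∈ Finset.Nat.antidiagonalTuple 4 d := by
      rw [Finset.Nat.mem_antidiagonalTuple, ← hm, Finsupp.degree_eq_sum]
    rw [Finset.sum_eq_single (⟨⇑m, hm'⟩ : Expo d)]
    · simp [formCoeffs]
    · intro α _ hα
      rw [if_neg]
      rintro rfl
      exact hα (Subtype.ext (by simp))
    · simp
  · rw [hP.coeff_eq_zero hm]
    refine Finset.sum_eq_zero fun α _ => ?_
    rw [if_neg]
    rintro rfl
    apply hm
    rw [Finsupp.degree_eq_sum]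
    simpa using Finset.Nat.mem_antidiagonalTuple.mp α.2

theorem formCoeffs_formPoly (a : Expo d → ℂ) : formCoeffs d (formPoly a) = a := by
  ext α
  simp only [formCoeffs, formPoly, LinearMap.coe_mk, AddHom.coe_mk, MvPolynomial.coeff_sum,
    MvPolynomial.coeff_monomial]
  rw [Finset.sum_eq_single α]
  · simp
  · intro β _ hβ
    rw [if_neg]
    intro h
    exact hβ (Subtype.ext (Finsupp.equivFunOnFinite.symm.injective h))
  · simp

theorem universalForm_formCoeffs {P : MvPolynomial (Fin 4) ℂ} (hP : P.IsHomogeneous d)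
    (w : Fin 4 → R) : universalForm (formCoeffs d P) w = MvPolynomial.aeval w P := by
  rw [← aeval_formPoly, formPoly_formCoeffs hP]

theorem universalForm_add (a b : Expo d → ℂ) (w : Fin 4 → R) :
    universalForm (a + b) w = universalForm a w + universalForm b w := by
  rw [← aeval_formPoly, ← aeval_formPoly, ← aeval_formPoly, formPoly_add, map_add]

theorem universalForm_smul (c : ℂ) (a : Expo d → ℂ) (w : Fin 4 → R) :
    universalForm (c • a) w = c • universalForm a w := by
  rw [← aeval_formPoly, ← aeval_formPoly, formPoly_smul, map_smul]

theorem universalForm_zero (w : Fin 4 → R) : universalForm (0 : Expo d → ℂ) w = 0 := by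
  simp [universalForm]

theorem universalForm_mul_right (a : Expo d → ℂ) (w : Fin 4 → R) (r : R) :
    universalForm a (fun i => w i * r) = r ^ d * universalForm a w := by
  rw [universalForm, universalForm, Finset.mul_sum]
  refine Finset.sum_congr rfl fun α _ => ?_
  have h := Finset.Nat.mem_antidiagonalTuple.mp α.2
  simp_rw [mul_pow, Finset.prod_mul_distrib, Finset.prod_pow_eq_pow_sum, h]
  ring

end Forms

theorem TruncEq.universalForm {d n : ℕ} {u v : Fin 4 → PowerSeries ℂ}
    (H : ∀ i, TruncEq n (u i) (v i)) (a : Expo d → ℂ) :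
    TruncEq n (universalForm a u) (_root_.universalForm a v) := by
  rw [← aeval_formPoly, ← aeval_formPoly]
  exact TruncEq.aeval H _

theorem constantCoeff_universalForm {d : ℕ} (a : Expo d → ℂ) (w : Fin 4 → PowerSeries ℂ) :
    PowerSeries.constantCoeff (universalForm a w) =
      universalForm a fun i => PowerSeries.constantCoeff (w i) := by
  simp [universalForm, map_sum, map_mul, map_prod]


/-! ### The action of reparametrisations of the homogeneous coordinates -/

/-- The change of homogeneous coordinates `(Z, a, η) ↦ (λ Z, μ a, η + d λ' / λ)`. -/
def jetAct {d : ℕ} (lam : PowerSeries ℂ) (mu : ℂ) (x : JetCoords d) : JetCoords d :=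
  (fun k l => PowerSeries.coeff (k : ℕ) (coordSeries x.1 l * lam), mu • x.2.1,
    fun k => x.2.2 k + d * PowerSeries.coeff (k : ℕ) (PowerSeries.derivative ℂ lam * lam⁻¹))

/-- The linear part of `jetAct`. -/
def jetActLinear {d : ℕ} (lam : PowerSeries ℂ) (mu : ℂ) (v : JetCoords d) : JetCoords d :=
  (fun k l => PowerSeries.coeff (k : ℕ) (coordSeries v.1 l * lam), mu • v.2.1, v.2.2)

/-- The universal form along a jet. -/
def formAlong {d : ℕ} (x : JetCoords d) : PowerSeries ℂ :=
  universalForm x.2.1 (coordSeries x.1)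

section Action

variable {d : ℕ} {lam : PowerSeries ℂ} {mu : ℂ}

theorem jetAct_add_smul (x v : JetCoords d) (r : ℂ) :
    jetAct lam mu (x + r • v) = jetAct lam mu x + r • jetActLinear lam mu v := by
  refine Prod.ext ?_ (Prod.ext ?_ ?_)
  · funext k l
    simp [jetAct, jetActLinear, coordSeries_add, coordSeries_smul, add_mul]
  · simp [jetAct, jetActLinear, smul_add, smul_comm mu r]
  · funext k
    simp [jetAct, jetActLinear]
    ring

theorem truncEq_coordSeries_jetAct (x : JetCoords d) (l : Fin 4) :
    TruncEq 4 (coordSeries (jetAct lam mu x).1 l) (coordSeries x.1 l * lam) :=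
  truncEq_coordSeries (fun l => coordSeries x.1 l * lam) l

theorem constantCoeff_mul_ne_zero {f g : PowerSeries ℂ} (hf : PowerSeries.constantCoeff f ≠ 0)
    (hg : PowerSeries.constantCoeff g ≠ 0) : PowerSeries.constantCoeff (f * g) ≠ 0 := by
  rw [map_mul]; exact mul_ne_zero hf hg

theorem constantCoeff_inv_ne_zero {f : PowerSeries ℂ} (hf : PowerSeries.constantCoeff f ≠ 0) :
    PowerSeries.constantCoeff f⁻¹ ≠ 0 := by
  rw [PowerSeries.constantCoeff_inv]; exact inv_ne_zero hf

theorem logDerivative_mul {f g : PowerSeries ℂ} (hf : PowerSeries.constantCoeff f ≠ 0)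
    (hg : PowerSeries.constantCoeff g ≠ 0) :
    PowerSeries.derivative ℂ (f * g) * (f * g)⁻¹ =
      PowerSeries.derivative ℂ f * f⁻¹ + PowerSeries.derivative ℂ g * g⁻¹ := by
  have h1 := PowerSeries.mul_inv_cancel f hf
  have h2 := PowerSeries.mul_inv_cancel g hg
  rw [PowerSeries.mul_inv_rev, Derivation.leibniz, smul_eq_mul, smul_eq_mul]
  linear_combination (PowerSeries.derivative ℂ g * g⁻¹) * h1 + PowerSeries.derivative ℂ f * f⁻¹ * h2

theorem logDerivative_inv {f : PowerSeries ℂ} (hf : PowerSeries.constantCoeff f ≠ 0) :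
    PowerSeries.derivative ℂ f⁻¹ * (f⁻¹)⁻¹ = -(PowerSeries.derivative ℂ f * f⁻¹) := by
  have h := logDerivative_mul hf (constantCoeff_inv_ne_zero hf)
  rw [PowerSeries.mul_inv_cancel f hf, PowerSeries.derivative_one, zero_mul] at h
  linear_combination -h

theorem truncEq_formAlong_jetAct (x : JetCoords d) :
    TruncEq 4 (formAlong (jetAct lam mu x)) (PowerSeries.C mu * lam ^ d * formAlong x) := by
  have h := TruncEq.universalForm (truncEq_coordSeries_jetAct (lam := lam) (mu := mu) x)
    (jetAct lam mu x).2.1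
  rw [universalForm_mul_right] at h
  refine h.trans ?_
  rw [show (jetAct lam mu x).2.1 = mu • x.2.1 from rfl, universalForm_smul,
    PowerSeries.smul_eq_C_mul, formAlong, ← mul_assoc, mul_comm (lam ^ d)]
  exact TruncEq.refl _ _

/-- The shift of `η` by `d λ'/λ` absorbs the derivative of `λ^d`, so the defect `s' - η s` is only
multiplied by the factor `μ λ^d` of `s`. -/
theorem jetEquations_jetAct (hlam : PowerSeries.constantCoeff lam ≠ 0) (x : JetCoords d)
    (k : Fin 3) :
    jetEquations d (jetAct lam mu x) k = PowerSeries.coeff (k : ℕ) (PowerSeries.C mu * lam ^ d *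
      (PowerSeries.derivative ℂ (formAlong x) - toSeries x.2.2 * formAlong x)) := by
  have hs := truncEq_formAlong_jetAct (lam := lam) (mu := mu) x
  have heta : TruncEq 3 (toSeries (jetAct lam mu x).2.2)
      (toSeries x.2.2 + PowerSeries.C (d : ℂ) * (PowerSeries.derivative ℂ lam * lam⁻¹)) := by
    intro k hk
    have h1 := coeff_toSeries (jetAct lam mu x).2.2 ⟨k, hk⟩
    have h2 := coeff_toSeries x.2.2 ⟨k, hk⟩
    simp only at h1 h2
    rw [h1, map_add, h2, PowerSeries.coeff_C_mul]
    rfl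
  have key := (hs.derivative.sub (heta.mul (hs.mono (by norm_num)))) k k.2
  refine key.trans ?_
  congr 1
  have hd : PowerSeries.derivative ℂ (lam ^ d) =
      PowerSeries.C (d : ℂ) * lam ^ d * lam⁻¹ * PowerSeries.derivative ℂ lam := by
    have h1 := PowerSeries.mul_inv_cancel lam hlam
    rw [PowerSeries.derivative_pow]
    rcases d with _ | e
    · simp
    · rw [pow_succ, Nat.add_sub_cancel, mul_assoc (PowerSeries.C _), mul_assoc (lam ^ e), h1]
      simp
  simp only [Derivation.leibniz, smul_eq_mul, PowerSeries.derivative_C, hd]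
  ring

end Action

/-! ### Normalisation into a chart. -/

section Chart

variable {d : ℕ} {i : Fin 4} {β : Expo d} {x : JetCoords d}

theorem toJetChart_eq_jetAct (hx : x.1 0 i ≠ 0) :
    toJetChart d i β x = jetAct (coordSeries x.1 i)⁻¹ (x.2.1 β)⁻¹ x := by
  have h0 : PowerSeries.constantCoeff (coordSeries x.1 i) ≠ 0 := by
    rwa [constantCoeff_coordSeries]
  refine Prod.ext rfl (Prod.ext ?_ ?_)
  · funext α
    simp [toJetChart, jetAct, div_eq_inv_mul]
  · funext k
    simp only [toJetChart, jetAct, logDerivative_inv h0, map_neg]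
    ring

/-- The normalisation is constant on orbits; the descent of fields rests on this invariance and on
its derivatives. -/
theorem toJetChart_jetAct {lam : PowerSeries ℂ} {mu : ℂ} (hx : x.1 0 i ≠ 0)
    (hlam : PowerSeries.constantCoeff lam ≠ 0) (hmu : mu ≠ 0) :
    toJetChart d i β (jetAct lam mu x) = toJetChart d i β x := by
  have h0 : PowerSeries.constantCoeff (coordSeries x.1 i) ≠ 0 := by
    rwa [constantCoeff_coordSeries]
  have hi := (truncEq_coordSeries_jetAct (lam := lam) (mu := mu) x i)
  have hinv : TruncEq 4 (coordSeries (jetAct lam mu x).1 i)⁻¹ (coordSeries x.1 i * lam)⁻¹ :=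
    (hi.symm.inv (constantCoeff_mul_ne_zero h0 hlam)).symm
  refine Prod.ext ?_ (Prod.ext ?_ ?_)
  · funext k l
    refine ((truncEq_coordSeries_jetAct x l).mul hinv k k.2).trans ?_
    rw [PowerSeries.mul_inv_rev]
    simp only [toJetChart]
    congr 1
    linear_combination (coordSeries x.1 l * (coordSeries x.1 i)⁻¹) *
      PowerSeries.mul_inv_cancel lam hlam
  · funext α
    simp [toJetChart, jetAct, mul_div_mul_left _ _ hmu]
  · funext k
    have h := (hi.derivative.mul (hinv.mono (by norm_num : 3 ≤ 4))) k k.2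
    rw [logDerivative_mul h0 hlam, map_add] at h
    simp only [toJetChart, h]
    simp only [jetAct]
    ring

theorem toJetChart_toJetChart {j : Fin 4} {γ : Expo d} (hj : x.1 0 j ≠ 0) (hi : x.1 0 i ≠ 0)
    (hβ : x.2.1 β ≠ 0) :
    toJetChart d j γ (toJetChart d i β x) = toJetChart d j γ x := by
  rw [toJetChart_eq_jetAct hi]
  refine toJetChart_jetAct hj (constantCoeff_inv_ne_zero ?_) (inv_ne_zero hβ)
  rwa [constantCoeff_coordSeries]

theorem coordSeries_eq_one (hx : ∀ k, x.1 k i = if k = 0 then 1 else 0) :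
    coordSeries x.1 i = 1 := by
  ext n
  simp only [coordSeries, toSeries, map_sum, PowerSeries.coeff_monomial, hx,
    PowerSeries.coeff_one]
  rw [Fin.sum_univ_four]
  rcases n with _ | n <;> simp

theorem toJetChart_eq_self (hx : ∀ k, x.1 k i = if k = 0 then 1 else 0) (hβ : x.2.1 β = 1) :
    toJetChart d i β x = x := by
  have h1 := coordSeries_eq_one hx
  have hinv : (1 : PowerSeries ℂ)⁻¹ = 1 := by
    have := PowerSeries.mul_inv_cancel (1 : PowerSeries ℂ) (by simp)
    rwa [one_mul] at this
  refine Prod.ext ?_ (Prod.ext ?_ ?_)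
  · funext k l
    simp [toJetChart, h1, hinv, coeff_coordSeries]
  · funext α
    simp [toJetChart, hβ]
  · funext k
    simp [toJetChart, h1]

/-- The image of the change of charts is normalised. -/
theorem toJetChart_normalised (hx : x.1 0 i ≠ 0) (k : Fin 4) :
    (toJetChart d i β x).1 k i = if k = 0 then 1 else 0 := by
  have h0 : PowerSeries.constantCoeff (coordSeries x.1 i) ≠ 0 := by
    rwa [constantCoeff_coordSeries]
  simp only [toJetChart, PowerSeries.mul_inv_cancel _ h0, PowerSeries.coeff_one]
  simp only [Fin.val_eq_zero_iff]

theorem toJetChart_coeff (hβ : x.2.1 β ≠ 0) : (toJetChart d i β x).2.1 β = 1 := by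
  simp [toJetChart, hβ]

end Chart

/-! ### Analytic families of power series -/

section Analytic

variable {E : Type*} [NormedAddCommGroup E] [NormedSpace ℂ E]

/-- A family of power series all of whose coefficients are analytic at `x`. -/
def SeriesAnalyticAt (f : E → PowerSeries ℂ) (x : E) : Prop :=
  ∀ k, AnalyticAt ℂ (fun y => PowerSeries.coeff k (f y)) x

namespace SeriesAnalyticAt

variable {f g : E → PowerSeries ℂ} {x : E}

theorem const (f : PowerSeries ℂ) : SeriesAnalyticAt (fun _ : E => f) x :=
  fun _ => analyticAt_const

theorem sub (hf : SeriesAnalyticAt f x) (hg : SeriesAnalyticAt g x) :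
    SeriesAnalyticAt (fun y => f y - g y) x := fun k => by
  simp only [map_sub]; exact (hf k).sub (hg k)

theorem mul (hf : SeriesAnalyticAt f x) (hg : SeriesAnalyticAt g x) :
    SeriesAnalyticAt (fun y => f y * g y) x := fun k => by
  simp only [PowerSeries.coeff_mul]
  exact Finset.analyticAt_fun_sum _ fun p _ => (hf p.1).mul (hg p.2)

theorem pow (hf : SeriesAnalyticAt f x) (m : ℕ) : SeriesAnalyticAt (fun y => f y ^ m) x := by
  induction m with
  | zero => simpa using const 1
  | succ m ih => simpa only [pow_succ] using ih.mul hf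

theorem prod {ι : Type*} (s : Finset ι) {u : ι → E → PowerSeries ℂ}
    (hu : ∀ i, SeriesAnalyticAt (u i) x) : SeriesAnalyticAt (fun y => ∏ i ∈ s, u i y) x := by
  classical
  induction s using Finset.induction_on with
  | empty => simpa using const 1
  | insert i s hi ih => simpa only [Finset.prod_insert hi] using (hu i).mul ih

theorem sum {ι : Type*} (s : Finset ι) {u : ι → E → PowerSeries ℂ}
    (hu : ∀ i, SeriesAnalyticAt (u i) x) : SeriesAnalyticAt (fun y => ∑ i ∈ s, u i y) x :=
  fun k => by
    simp only [map_sum]; exact Finset.analyticAt_fun_sum _ fun i _ => hu i k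

theorem derivative (hf : SeriesAnalyticAt f x) :
    SeriesAnalyticAt (fun y => PowerSeries.derivative ℂ (f y)) x := fun k => by
  simp only [PowerSeries.coeff_derivative]; exact (hf _).mul analyticAt_const

theorem C {u : E → ℂ} (hu : AnalyticAt ℂ u x) :
    SeriesAnalyticAt (fun y => PowerSeries.C (u y)) x := fun k => by
  simp only [PowerSeries.coeff_C]
  by_cases hk : k = 0
  · simpa [hk] using hu
  · simpa [hk] using analyticAt_const

theorem toSeries {n : ℕ} {c : E → Fin n → ℂ} (hc : ∀ k, AnalyticAt ℂ (fun y => c y k) x) :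
    SeriesAnalyticAt (fun y => toSeries (c y)) x := by
  refine sum _ fun i k => ?_
  simp only [PowerSeries.coeff_monomial]
  by_cases hk : k = (i : ℕ)
  · simpa [hk] using hc i
  · simpa [hk] using analyticAt_const

theorem inv (hf : SeriesAnalyticAt f x) (h0 : PowerSeries.constantCoeff (f x) ≠ 0) :
    SeriesAnalyticAt (fun y => (f y)⁻¹) x := by
  have h0' : AnalyticAt ℂ (fun y => (PowerSeries.constantCoeff (f y))⁻¹) x := by
    have := hf 0
    simp only [PowerSeries.coeff_zero_eq_constantCoeff] at this
    exact this.inv h0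
  intro k
  -- The recursion for the coefficients of an inverse involves only earlier ones and the inverse of
  -- the constant term.
  induction k using Nat.strong_induction_on with
  | _ k ih =>
    rw [funext fun y => PowerSeries.coeff_inv k (f y)]
    by_cases hk : k = 0
    · simpa [hk] using h0'
    · simp only [if_neg hk]
      refine h0'.neg.mul (Finset.analyticAt_fun_sum _ fun p _ => ?_)
      by_cases hp : p.2 < k
      · simp only [if_pos hp]
        exact (hf p.1).mul (ih _ hp)
      · simpa [hp] using analyticAt_const

end SeriesAnalyticAt

end Analytic

/-! ### Analyticity of the equations and of the chart changes. -/

section JetAnalytic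

variable {d : ℕ} {x : JetCoords d}

theorem analyticAt_coord (k l : Fin 4) : AnalyticAt ℂ (fun y : JetCoords d => y.1 k l) x :=
  ((ContinuousLinearMap.proj (R := ℂ) (φ := fun _ : Fin 4 => ℂ) l).comp
    ((ContinuousLinearMap.proj (R := ℂ) (φ := fun _ : Fin 4 => Fin 4 → ℂ) k).comp
      (ContinuousLinearMap.fst ℂ _ _))).analyticAt x

theorem analyticAt_coeff (α : Expo d) : AnalyticAt ℂ (fun y : JetCoords d => y.2.1 α) x :=
  ((ContinuousLinearMap.proj (R := ℂ) (φ := fun _ : Expo d => ℂ) α).comp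
    ((ContinuousLinearMap.fst ℂ _ _).comp (ContinuousLinearMap.snd ℂ _ _))).analyticAt x

theorem analyticAt_logCoord (k : Fin 3) : AnalyticAt ℂ (fun y : JetCoords d => y.2.2 k) x :=
  ((ContinuousLinearMap.proj (R := ℂ) (φ := fun _ : Fin 3 => ℂ) k).comp
    ((ContinuousLinearMap.snd ℂ _ _).comp (ContinuousLinearMap.snd ℂ _ _))).analyticAt x

theorem seriesAnalyticAt_coordSeries (l : Fin 4) :
    SeriesAnalyticAt (fun y : JetCoords d => coordSeries y.1 l) x :=
  SeriesAnalyticAt.toSeries fun k => analyticAt_coord k l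

theorem seriesAnalyticAt_formAlong : SeriesAnalyticAt (fun y : JetCoords d => formAlong y) x := by
  have h : (fun y : JetCoords d => formAlong y) = fun y =>
      ∑ α : Expo d, PowerSeries.C (y.2.1 α) * ∏ l, coordSeries y.1 l ^ α.1 l := by
    funext y
    simp [formAlong, universalForm]
  rw [h]
  exact SeriesAnalyticAt.sum _ fun α =>
    (SeriesAnalyticAt.C (analyticAt_coeff α)).mul
      (SeriesAnalyticAt.prod _ fun l => (seriesAnalyticAt_coordSeries l).pow _)

theorem analyticAt_jetEquations : AnalyticAt ℂ (jetEquations d) x :=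
  AnalyticAt.pi fun k =>
    (seriesAnalyticAt_formAlong.derivative.sub
      ((SeriesAnalyticAt.toSeries analyticAt_logCoord).mul seriesAnalyticAt_formAlong)) k

theorem analyticAt_toJetChart {i : Fin 4} {β : Expo d} (hi : x.1 0 i ≠ 0) (hβ : x.2.1 β ≠ 0) :
    AnalyticAt ℂ (toJetChart d i β) x := by
  have hinv : SeriesAnalyticAt (fun y : JetCoords d => (coordSeries y.1 i)⁻¹) x :=
    (seriesAnalyticAt_coordSeries i).inv (by rwa [constantCoeff_coordSeries])
  refine AnalyticAt.prod ?_ (AnalyticAt.prod ?_ ?_)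
  · exact AnalyticAt.pi fun k => AnalyticAt.pi fun l =>
      ((seriesAnalyticAt_coordSeries l).mul hinv) k
  · exact AnalyticAt.pi fun α => (analyticAt_coeff α).div (analyticAt_coeff β) hβ
  · exact AnalyticAt.pi fun k => (analyticAt_logCoord k).sub
      (analyticAt_const.mul (((seriesAnalyticAt_coordSeries i).derivative.mul hinv) k))

end JetAnalytic


/-! ### Derivatives along lines -/

/-- `f'` is the coefficientwise derivative at `0` of the path `f` of power series. -/
def SeriesHasDerivAt (f : ℂ → PowerSeries ℂ) (f' : PowerSeries ℂ) : Prop :=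
  ∀ k, HasDerivAt (fun r => PowerSeries.coeff k (f r)) (PowerSeries.coeff k f') 0

namespace SeriesHasDerivAt

variable {f g : ℂ → PowerSeries ℂ} {f' g' : PowerSeries ℂ}

theorem const (f : PowerSeries ℂ) : SeriesHasDerivAt (fun _ => f) 0 := fun k => by
  simpa using hasDerivAt_const (0 : ℂ) (PowerSeries.coeff k f)

theorem add (hf : SeriesHasDerivAt f f') (hg : SeriesHasDerivAt g g') :
    SeriesHasDerivAt (fun r => f r + g r) (f' + g') := fun k => by
  simp only [map_add]; exact (hf k).add (hg k)

theorem sub (hf : SeriesHasDerivAt f f') (hg : SeriesHasDerivAt g g') :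
    SeriesHasDerivAt (fun r => f r - g r) (f' - g') := fun k => by
  simp only [map_sub]; exact (hf k).sub (hg k)

theorem mul (hf : SeriesHasDerivAt f f') (hg : SeriesHasDerivAt g g') :
    SeriesHasDerivAt (fun r => f r * g r) (f' * g 0 + f 0 * g') := fun k => by
  simp only [PowerSeries.coeff_mul, map_add]
  rw [← Finset.sum_add_distrib]
  exact HasDerivAt.fun_sum fun p _ => (hf p.1).mul (hg p.2)

theorem line (f v : PowerSeries ℂ) : SeriesHasDerivAt (fun r => f + r • v) v := fun k => by
  have h := ((hasDerivAt_id (0 : ℂ)).mul_const (PowerSeries.coeff k v)).const_add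
    (PowerSeries.coeff k f)
  simpa using h

theorem derivative (hf : SeriesHasDerivAt f f') :
    SeriesHasDerivAt (fun r => PowerSeries.derivative ℂ (f r)) (PowerSeries.derivative ℂ f') :=
  fun k => by
    simp only [PowerSeries.coeff_derivative]; exact (hf _).mul_const _

theorem aeval {w : ℂ → Fin 4 → PowerSeries ℂ} {w' : Fin 4 → PowerSeries ℂ}
    (hw : ∀ i, SeriesHasDerivAt (fun r => w r i) (w' i)) (P : MvPolynomial (Fin 4) ℂ) :
    SeriesHasDerivAt (fun r => MvPolynomial.aeval (w r) P)
      (∑ i, MvPolynomial.aeval (w 0) (MvPolynomial.pderiv i P) * w' i) := by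
  induction P using MvPolynomial.induction_on with
  | C c => simpa using const _
  | add p q hp hq =>
    simpa only [map_add, add_mul, Finset.sum_add_distrib] using hp.add hq
  | mul_X p j hp =>
    have h := hp.mul (hw j)
    simp only [map_mul, MvPolynomial.aeval_X]
    convert h using 1
    simp only [Derivation.leibniz, MvPolynomial.pderiv_X, smul_eq_mul, map_add, map_mul,
      MvPolynomial.aeval_X, add_mul, Finset.sum_add_distrib, Finset.sum_mul]
    rw [add_comm]
    congr 1
    · exact Finset.sum_congr rfl fun i _ => by ring
    · rw [Finset.sum_eq_single j]
      · simp
      · intro i _ hi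
        simp [Pi.single_eq_of_ne' hi]
      · simp

end SeriesHasDerivAt

/-- The derivative of `formAlong` at `x` in the direction `v`. -/
def formAlongDeriv {d : ℕ} (x v : JetCoords d) : PowerSeries ℂ :=
  universalForm v.2.1 (coordSeries x.1) +
    ∑ i, MvPolynomial.aeval (coordSeries x.1) (MvPolynomial.pderiv i (formPoly x.2.1)) *
      coordSeries v.1 i

/-! ### The differential of the jet equations. -/

section Jets

variable {d : ℕ}

theorem seriesHasDerivAt_formAlong (x v : JetCoords d) :
    SeriesHasDerivAt (fun r => formAlong (x + r • v)) (formAlongDeriv x v) := by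
  have hw : ∀ i, SeriesHasDerivAt (fun r : ℂ => coordSeries (x + r • v).1 i)
      (coordSeries v.1 i) := fun i => by
    have h := SeriesHasDerivAt.line (coordSeries x.1 i) (coordSeries v.1 i)
    simpa [coordSeries_add, coordSeries_smul] using h
  have h1 := SeriesHasDerivAt.aeval hw (formPoly x.2.1)
  -- By linearity in the coefficients the path is `F_a + r F_b` along the moving jet, where `b` is
  -- the coefficient part of `v`; the second term contributes only `F_b` on the fixed jet.
  have h2 := (SeriesHasDerivAt.line 0 1).mul (SeriesHasDerivAt.aeval hw (formPoly v.2.1))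
  have h := h1.add h2
  simp only [zero_smul, add_zero, zero_mul, one_mul] at h
  convert h using 1
  · funext r
    rw [formAlong, aeval_formPoly, aeval_formPoly]
    simp [universalForm_add, universalForm_smul]
  · rw [formAlongDeriv, add_comm, aeval_formPoly]

theorem fderiv_apply_eq_of_hasDerivAt {E F : Type*} [NormedAddCommGroup E] [NormedSpace ℂ E]
    [NormedAddCommGroup F] [NormedSpace ℂ F] {f : E → F} {x v : E} {f' : F}
    (hf : DifferentiableAt ℂ f x) (h : HasDerivAt (fun r : ℂ => f (x + r • v)) f' 0) :
    fderiv ℂ f x v = f' :=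
  (hf.hasFDerivAt.hasLineDerivAt v).unique h

theorem hasDerivAt_line {E F : Type*} [NormedAddCommGroup E] [NormedSpace ℂ E]
    [NormedAddCommGroup F] [NormedSpace ℂ F] {f : E → F} {x : E}
    (hf : DifferentiableAt ℂ f x) (v : E) :
    HasDerivAt (fun r : ℂ => f (x + r • v)) (fderiv ℂ f x v) 0 :=
  hf.hasFDerivAt.hasLineDerivAt v

theorem fderiv_jetEquations (x v : JetCoords d) (k : Fin 3) :
    fderiv ℂ (jetEquations d) x v k = PowerSeries.coeff (k : ℕ)
      (PowerSeries.derivative ℂ (formAlongDeriv x v) -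
        (toSeries v.2.2 * formAlong x + toSeries x.2.2 * formAlongDeriv x v)) := by
  have hs := seriesHasDerivAt_formAlong x v
  have heta : SeriesHasDerivAt (fun r : ℂ => toSeries (x + r • v).2.2) (toSeries v.2.2) := by
    have h := SeriesHasDerivAt.line (toSeries x.2.2) (toSeries v.2.2)
    simpa [toSeries_add, toSeries_smul] using h
  have h := hs.derivative.sub (heta.mul hs)
  simp only [zero_smul, add_zero] at h
  have h' : HasDerivAt (fun r : ℂ => jetEquations d (x + r • v)) (fun k : Fin 3 =>
      PowerSeries.coeff (k : ℕ) (PowerSeries.derivative ℂ (formAlongDeriv x v) -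
        (toSeries v.2.2 * formAlong x + toSeries x.2.2 * formAlongDeriv x v))) 0 :=
    hasDerivAt_pi.mpr fun k => h k
  rw [fderiv_apply_eq_of_hasDerivAt analyticAt_jetEquations.differentiableAt h']

end Jets

/-! ### Vector fields in homogeneous coordinates -/

/-- An analytic vector field in homogeneous coordinates that descends: it is tangent to the equations, and
under a change of homogeneous coordinates it is multiplied by `λ(0)^c μ^m`. -/
structure IsHomogeneousField (d c m : ℕ) (V : JetCoords d → JetCoords d) : Prop where
  analytic : ∀ x, AnalyticAt ℂ V x
  tangent : ∀ x, fderiv ℂ (jetEquations d) x (V x) = 0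
  equivariant : ∀ x lam mu, PowerSeries.constantCoeff lam ≠ 0 → mu ≠ 0 →
    V (jetAct lam mu x) =
      (PowerSeries.constantCoeff lam ^ c * mu ^ m) • jetActLinear lam mu (V x)

/-! ### Descent of homogeneous fields to the charts. -/

section Descent

variable {d c m : ℕ}

/-- This is the derivative of the invariance under the group: for fixed `λ`, `μ` the action is
affine and carries the line `x + r v` to a line. -/
theorem fderiv_toJetChart_jetAct {i : Fin 4} {β : Expo d} {x : JetCoords d} (hi : x.1 0 i ≠ 0)
    (hβ : x.2.1 β ≠ 0) {lam : PowerSeries ℂ} {mu : ℂ}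
    (hlam : PowerSeries.constantCoeff lam ≠ 0) (hmu : mu ≠ 0) (v : JetCoords d) :
    fderiv ℂ (toJetChart d i β) (jetAct lam mu x) (jetActLinear lam mu v) =
      fderiv ℂ (toJetChart d i β) x v := by
  have hi' : (jetAct lam mu x).1 0 i ≠ 0 := by
    rw [← constantCoeff_coordSeries (jetAct lam mu x).1 i, ← PowerSeries.coeff_zero_eq_constantCoeff_apply,
      truncEq_coordSeries_jetAct x i 0 (by norm_num),
      PowerSeries.coeff_zero_eq_constantCoeff_apply]
    exact constantCoeff_mul_ne_zero (by rwa [constantCoeff_coordSeries]) hlam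
  have hβ' : (jetAct lam mu x).2.1 β ≠ 0 := mul_ne_zero hmu hβ
  refine fderiv_apply_eq_of_hasDerivAt (analyticAt_toJetChart hi' hβ').differentiableAt ?_
  refine (hasDerivAt_line (analyticAt_toJetChart hi hβ).differentiableAt v).congr_of_eventuallyEq ?_
  have hc : Continuous fun r : ℂ => (x + r • v).1 0 i := by
    simp only [Prod.fst_add, Prod.smul_fst, Pi.add_apply, Pi.smul_apply]
    fun_prop
  have hev : ∀ᶠ r : ℂ in 𝓝 0, (x + r • v).1 0 i ≠ 0 :=
    hc.continuousAt.eventually_ne (by simpa using hi)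
  filter_upwards [hev] with r hr
  rw [← jetAct_add_smul, toJetChart_jetAct hr hlam hmu]

theorem fderiv_apply_eq_zero_of_eventually_const {E F : Type*} [NormedAddCommGroup E]
    [NormedSpace ℂ E] [NormedAddCommGroup F] [NormedSpace ℂ F] {f : E → F} {x : E}
    (hf : DifferentiableAt ℂ f x) (φ : F →L[ℂ] ℂ) (a : ℂ) (h : ∀ᶠ y in 𝓝 x, φ (f y) = a) (v : E) :
    φ (fderiv ℂ f x v) = 0 := by
  have h1 : HasFDerivAt (fun y => φ (f y)) (φ.comp (fderiv ℂ f x)) x :=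
    φ.hasFDerivAt.comp x hf.hasFDerivAt
  have h2 : HasFDerivAt (fun y => φ (f y)) (0 : E →L[ℂ] ℂ) x :=
    (hasFDerivAt_const a x).congr_of_eventuallyEq h
  exact DFunLike.congr_fun (h1.unique h2) v

theorem eventually_chart_ne_zero {i : Fin 4} {β : Expo d} {x : JetCoords d} (hi : x.1 0 i ≠ 0)
    (hβ : x.2.1 β ≠ 0) : ∀ᶠ y : JetCoords d in 𝓝 x, y.1 0 i ≠ 0 ∧ y.2.1 β ≠ 0 :=
  ((analyticAt_coord (x := x) 0 i).continuousAt.eventually_ne hi).and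
    ((analyticAt_coeff (x := x) β).continuousAt.eventually_ne hβ)

/-- Composed with the normalisation, the equations become coefficients of `a_β⁻¹ Z_i^(-d) (s' - η
s)`. At `x` the second factor vanishes below order three, and so does its derivative along `v`; by
the product rule nothing survives. -/
theorem fderiv_jetEquations_fderiv_toJetChart {i : Fin 4} {β : Expo d} {x : JetCoords d}
    (hx : x ∈ jetChart d i β) {v : JetCoords d} (hv : fderiv ℂ (jetEquations d) x v = 0) :
    fderiv ℂ (jetEquations d) x (fderiv ℂ (toJetChart d i β) x v) = 0 := by
  obtain ⟨⟨-, -, hx0⟩, hi, hβ⟩ := hx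
  have hi0 : x.1 0 i ≠ 0 := by simp [hi]
  have hβ0 : x.2.1 β ≠ 0 := by simp [hβ]
  have hT := toJetChart_eq_self hi hβ
  have hTd : DifferentiableAt ℂ (toJetChart d i β) x :=
    (analyticAt_toJetChart hi0 hβ0).differentiableAt
  have hE : DifferentiableAt ℂ (jetEquations d) (toJetChart d i β x) :=
    analyticAt_jetEquations.differentiableAt
  have hcomp := fderiv_comp x hE hTd
  rw [hT] at hcomp
  have hgoal : fderiv ℂ (jetEquations d ∘ toJetChart d i β) x v = 0 := by
    refine fderiv_apply_eq_of_hasDerivAt (hE.comp x hTd) ?_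
    refine hasDerivAt_pi.mpr fun k => ?_
    have hu : SeriesAnalyticAt (fun y : JetCoords d =>
        PowerSeries.C (y.2.1 β)⁻¹ * (coordSeries y.1 i)⁻¹ ^ d) x :=
      (SeriesAnalyticAt.C ((analyticAt_coeff β).inv hβ0)).mul
        (((seriesAnalyticAt_coordSeries i).inv (by rwa [constantCoeff_coordSeries])).pow d)
    have hline : ∀ p ∈ Finset.HasAntidiagonal.antidiagonal (k : ℕ), HasDerivAt (fun r : ℂ =>
        PowerSeries.coeff p.1 (PowerSeries.C ((x + r • v).2.1 β)⁻¹ *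
            (coordSeries (x + r • v).1 i)⁻¹ ^ d) *
          PowerSeries.coeff p.2 (PowerSeries.derivative ℂ (formAlong (x + r • v)) -
            toSeries (x + r • v).2.2 * formAlong (x + r • v))) 0 0 := by
      intro p hp
      have hp3 : p.2 < 3 := by
        have := Finset.HasAntidiagonal.mem_antidiagonal.mp hp
        have := k.2
        omega
      have h1 := hasDerivAt_line (hu p.1).differentiableAt v
      have h2 := hasDerivAt_pi.mp
        (hasDerivAt_line (analyticAt_jetEquations (x := x)).differentiableAt v) ⟨p.2, hp3⟩
      rw [hv] at h2
      have h3 := h1.mul h2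
      have hx0' := congrFun hx0 ⟨p.2, hp3⟩
      simp only [zero_smul, add_zero, hx0', Pi.zero_apply, mul_zero] at h3
      exact h3
    have hsum := HasDerivAt.fun_sum hline
    simp only [Finset.sum_const_zero] at hsum
    refine hsum.congr_of_eventuallyEq ?_
    have hc : Continuous fun r : ℂ => (x + r • v).1 0 i := by
      simp only [Prod.fst_add, Prod.smul_fst, Pi.add_apply, Pi.smul_apply]
      fun_prop
    have hev : ∀ᶠ r : ℂ in 𝓝 0, (x + r • v).1 0 i ≠ 0 :=
      hc.continuousAt.eventually_ne (by simpa using hi0)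
    filter_upwards [hev] with r hr
    rw [Function.comp_apply, toJetChart_eq_jetAct hr, jetEquations_jetAct, PowerSeries.coeff_mul]
    exact constantCoeff_inv_ne_zero (by rwa [constantCoeff_coordSeries])
  rw [hcomp] at hgoal
  exact hgoal

theorem fderiv_toJetChart_mem_jetTangentSpace {i : Fin 4} {β : Expo d} {x : JetCoords d}
    (hx : x ∈ jetChart d i β) {v : JetCoords d} (hv : fderiv ℂ (jetEquations d) x v = 0) :
    fderiv ℂ (toJetChart d i β) x v ∈ jetTangentSpace d i β x := by
  have hi0 : x.1 0 i ≠ 0 := by simp [hx.2.1]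
  have hβ0 : x.2.1 β ≠ 0 := by simp [hx.2.2]
  have hTd : DifferentiableAt ℂ (toJetChart d i β) x :=
    (analyticAt_toJetChart hi0 hβ0).differentiableAt
  refine ⟨fun k => ?_, ?_, fderiv_jetEquations_fderiv_toJetChart hx hv⟩
  · refine fderiv_apply_eq_zero_of_eventually_const hTd
      ((ContinuousLinearMap.proj (R := ℂ) (φ := fun _ : Fin 4 => ℂ) i).comp
        ((ContinuousLinearMap.proj (R := ℂ) (φ := fun _ : Fin 4 => Fin 4 → ℂ) k).comp
          (ContinuousLinearMap.fst ℂ _ _))) (if k = 0 then 1 else 0) ?_ v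
    filter_upwards [eventually_chart_ne_zero hi0 hβ0] with y hy
    exact toJetChart_normalised (β := β) hy.1 k
  · refine fderiv_apply_eq_zero_of_eventually_const hTd
      ((ContinuousLinearMap.proj (R := ℂ) (φ := fun _ : Expo d => ℂ) β).comp
        ((ContinuousLinearMap.fst ℂ _ _).comp (ContinuousLinearMap.snd ℂ _ _))) 1 ?_ v
    filter_upwards [eventually_chart_ne_zero hi0 hβ0] with y hy
    exact toJetChart_coeff (i := i) hy.2

/-- A homogeneous field descends to a section of the twisted tangent bundle. -/
def IsHomogeneousField.toTwisted {V : JetCoords d → JetCoords d} (hV : IsHomogeneousField d c m V) :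
    TwistedJetField d c m where
  field i β x := fderiv ℂ (toJetChart d i β) x (V x)
  holomorphic i β x hx := by
    refine ⟨fun x => fderiv ℂ (toJetChart d i β) x (V x), ?_, Filter.Eventually.of_forall
      fun _ => rfl⟩
    have hT := (analyticAt_toJetChart (i := i) (β := β) (x := x) (by simp [hx.2.1])
      (by simp [hx.2.2])).fderiv
    exact ((ContinuousLinearMap.id ℂ (JetCoords d →L[ℂ] JetCoords d)).analyticAt_bilinear
      (fderiv ℂ (toJetChart d i β) x, V x)).comp₂ hT (hV.analytic x)
  tangent i β x hx := fderiv_toJetChart_mem_jetTangentSpace hx (hV.tangent x)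
  compatible i β j γ x hx hj hγ := by
    have hi0 : x.1 0 i ≠ 0 := by simp [hx.2.1]
    have hβ0 : x.2.1 β ≠ 0 := by simp [hx.2.2]
    have hT := toJetChart_eq_self hx.2.1 hx.2.2
    have hl : PowerSeries.constantCoeff (coordSeries x.1 j)⁻¹ ≠ 0 :=
      constantCoeff_inv_ne_zero (by rwa [constantCoeff_coordSeries])
    -- Near `x`, normalising first in `(i, β)` does not affect the normalisation in `(j, γ)`.
    have hcomp : fderiv ℂ (toJetChart d j γ) x (fderiv ℂ (toJetChart d i β) x (V x)) =
        fderiv ℂ (toJetChart d j γ) x (V x) := by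
      have h1 : (toJetChart d j γ ∘ toJetChart d i β) =ᶠ[𝓝 x] toJetChart d j γ := by
        filter_upwards [eventually_chart_ne_zero hi0 hβ0, eventually_chart_ne_zero hj hγ]
          with y hy hy'
        exact toJetChart_toJetChart hy'.1 hy.1 hy.2
      have h2 := fderiv_comp x (f := toJetChart d i β) (g := toJetChart d j γ)
        (by rw [hT]; exact (analyticAt_toJetChart hj hγ).differentiableAt)
        (analyticAt_toJetChart hi0 hβ0).differentiableAt
      rw [h1.fderiv_eq, hT] at h2
      exact (DFunLike.congr_fun h2 (V x)).symm
    -- The change of charts is the action of `λ = Z_j⁻¹`, `μ = a_γ⁻¹`, and the weight for these is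
    -- the transition function.
    rw [hcomp, toJetChart_eq_jetAct hj, hV.equivariant _ _ _ hl (inv_ne_zero hγ), map_smul,
      fderiv_toJetChart_jetAct hj hγ hl (inv_ne_zero hγ)]
    rw [PowerSeries.constantCoeff_inv, constantCoeff_coordSeries, inv_pow, inv_pow, mul_inv]

end Descent


/-! ### Matrices of coefficients -/

/-- The `4 × 4` matrix of the first four coefficients of four power series. -/
def coeffMatrix (w : Fin 4 → PowerSeries ℂ) : Matrix (Fin 4) (Fin 4) ℂ :=
  Matrix.of fun c k => PowerSeries.coeff (k : ℕ) (w c)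

/-- The matrix of the multiplication by `f` on `ℂ[t]/(t⁴)`. -/
def shiftMatrix (f : PowerSeries ℂ) : Matrix (Fin 4) (Fin 4) ℂ :=
  coeffMatrix fun j => PowerSeries.X ^ (j : ℕ) * f

/-- The first four coefficients of a power series. -/
def coeffRow (f : PowerSeries ℂ) : Fin 4 → ℂ := fun k => PowerSeries.coeff (k : ℕ) f

theorem coeffMatrix_congr {w w' : Fin 4 → PowerSeries ℂ} (h : ∀ c, TruncEq 4 (w c) (w' c)) :
    coeffMatrix w = coeffMatrix w' := by
  ext c k; exact h c k k.2

theorem coeffRow_congr {f g : PowerSeries ℂ} (h : TruncEq 4 f g) : coeffRow f = coeffRow g :=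
  funext fun k => h k k.2

theorem truncEq_of_coeffRow {f g : PowerSeries ℂ} (h : coeffRow f = coeffRow g) :
    TruncEq 4 f g :=
  fun k hk => congrFun h ⟨k, hk⟩

theorem coeffRow_mul (g f : PowerSeries ℂ) :
    coeffRow (g * f) = Matrix.vecMul (coeffRow g) (shiftMatrix f) := by
  funext k
  have h := ((truncEq_toSeries (n := 4) g).mul (TruncEq.refl 4 f)) k k.2
  rw [coeffRow, ← h, toSeries, Finset.sum_mul, map_sum, Matrix.vecMul, dotProduct]
  refine Finset.sum_congr rfl fun j _ => ?_
  have hm : PowerSeries.monomial (j : ℕ) (PowerSeries.coeff (j : ℕ) g) =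
      PowerSeries.coeff (j : ℕ) g • PowerSeries.X ^ (j : ℕ) := by
    rw [PowerSeries.X_pow_eq, ← map_smul, smul_eq_mul, mul_one]
  rw [hm, smul_mul_assoc, map_smul]
  rfl

theorem coeffMatrix_mul (w : Fin 4 → PowerSeries ℂ) (f : PowerSeries ℂ) :
    coeffMatrix (fun c => w c * f) = coeffMatrix w * shiftMatrix f := by
  ext c k
  exact congrFun (coeffRow_mul (w c) f) k

/-- Multiplication by `f` never lowers the order in `t`, so the matrix is triangular with `f(0)` on
the diagonal. -/
theorem det_shiftMatrix (f : PowerSeries ℂ) :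
    (shiftMatrix f).det = PowerSeries.constantCoeff f ^ 4 := by
  rw [Matrix.det_of_isUpperTriangular]
  · simp [shiftMatrix, coeffMatrix, PowerSeries.coeff_X_pow_mul']
  · intro j k hjk
    simpa [shiftMatrix, coeffMatrix, PowerSeries.coeff_X_pow_mul'] using
      fun h : j ≤ k => absurd h (not_le.mpr hjk)

theorem coeffRow_sum_smul (u : Fin 4 → ℂ) (w : Fin 4 → PowerSeries ℂ) :
    coeffRow (∑ c, u c • w c) = Matrix.vecMul u (coeffMatrix w) := by
  funext k
  simp [coeffRow, coeffMatrix, Matrix.vecMul, dotProduct]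

section MatrixAnalytic

variable {E : Type*} [NormedAddCommGroup E] [NormedSpace ℂ E] {n : Type*} [Fintype n]
  [DecidableEq n] {A : E → Matrix n n ℂ} {x : E}

theorem analyticAt_det (hA : ∀ j k, AnalyticAt ℂ (fun y => A y j k) x) :
    AnalyticAt ℂ (fun y => (A y).det) x := by
  simp only [Matrix.det_apply']
  exact Finset.analyticAt_fun_sum _ fun σ _ => analyticAt_const.mul
    (Finset.analyticAt_fun_prod _ fun j _ => hA _ _)

theorem analyticAt_adjugate (hA : ∀ j k, AnalyticAt ℂ (fun y => A y j k) x) (p q : n) :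
    AnalyticAt ℂ (fun y => (A y).adjugate p q) x := by
  simp only [Matrix.adjugate_apply]
  refine analyticAt_det fun j k => ?_
  simp only [Matrix.updateRow_apply]
  by_cases hj : j = q
  · simpa [hj] using analyticAt_const
  · simpa [hj] using hA j k

end MatrixAnalytic

/-! ### Homogeneous fields -/

section Fields

variable {d c m : ℕ}

theorem jetAct_coord_zero (lam : PowerSeries ℂ) (mu : ℂ) (x : JetCoords d) (l : Fin 4) :
    (jetAct lam mu x).1 0 l = PowerSeries.constantCoeff lam * x.1 0 l := by
  rw [← constantCoeff_coordSeries x.1 l, mul_comm, ← map_mul]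
  simp [jetAct]

theorem formAlongDeriv_add (x v w : JetCoords d) :
    formAlongDeriv x (v + w) = formAlongDeriv x v + formAlongDeriv x w := by
  simp only [formAlongDeriv, Prod.snd_add, Prod.fst_add, universalForm_add, coordSeries_add,
    mul_add, Finset.sum_add_distrib]
  ring

/-- With `η` fixed, the linearised equation involves only the variation of `s` and its derivative.
Differentiation costs one order, which is why vanishing modulo `t⁴` is asked for. -/
theorem fderiv_jetEquations_eq_zero {x v : JetCoords d} (h : TruncEq 4 (formAlongDeriv x v) 0)
    (hv : v.2.2 = 0) : fderiv ℂ (jetEquations d) x v = 0 := by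
  funext k
  have h1 := (h.derivative.sub ((TruncEq.refl 3 (toSeries x.2.2)).mul
    (h.mono (by norm_num : 3 ≤ 4)))) k k.2
  have h0 : toSeries (0 : Fin 3 → ℂ) = 0 := by simp [toSeries]
  rw [fderiv_jetEquations, hv, h0, zero_mul, zero_add, h1]
  simp

theorem jetActLinear_add (lam : PowerSeries ℂ) (mu : ℂ) (v w : JetCoords d) :
    jetActLinear lam mu (v + w) = jetActLinear lam mu v + jetActLinear lam mu w := by
  refine Prod.ext ?_ (Prod.ext ?_ ?_)
  · funext k l
    simp [jetActLinear, coordSeries_add, add_mul]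
  · simp [jetActLinear]
  · simp [jetActLinear]

theorem jetActLinear_smul (lam : PowerSeries ℂ) (mu r : ℂ) (v : JetCoords d) :
    jetActLinear lam mu (r • v) = r • jetActLinear lam mu v := by
  refine Prod.ext ?_ (Prod.ext ?_ ?_)
  · funext k l
    simp [jetActLinear, coordSeries_smul]
  · simp [jetActLinear, smul_comm mu r]
  · simp [jetActLinear]

/-- The homogeneous fields form a vector space. -/
def homogeneousFields (d c m : ℕ) : Submodule ℂ (JetCoords d → JetCoords d) where
  carrier := {V | IsHomogeneousField d c m V}
  add_mem' {V W} hV hW :=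
    { analytic := fun x => (hV.analytic x).add (hW.analytic x)
      tangent := fun x => by
        rw [Pi.add_apply, map_add, hV.tangent, hW.tangent, add_zero]
      equivariant := fun x lam mu hl hm => by
        rw [Pi.add_apply, Pi.add_apply, hV.equivariant _ _ _ hl hm, hW.equivariant _ _ _ hl hm,
          jetActLinear_add, smul_add] }
  zero_mem' :=
    { analytic := fun _ => analyticAt_const
      tangent := fun _ => map_zero _
      equivariant := fun x lam mu _ _ => by
        have h := jetActLinear_smul lam mu 0 (0 : JetCoords d)
        rw [zero_smul, zero_smul] at h
        rw [Pi.zero_apply, Pi.zero_apply, h, smul_zero] }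
  smul_mem' r V hV :=
    { analytic := fun x => analyticAt_const.smul (hV.analytic x)
      tangent := fun x => by rw [Pi.smul_apply, map_smul, hV.tangent, smul_zero]
      equivariant := fun x lam mu hl hm => by
        rw [Pi.smul_apply, Pi.smul_apply, hV.equivariant _ _ _ hl hm, jetActLinear_smul,
          smul_comm] }

/-- The action of the matrix `A` on forms, `F ↦ ∑ (A X)_i ∂_i F`, on coefficients. -/
def derivForm (A : Matrix (Fin 4) (Fin 4) ℂ) : (Expo d → ℂ) →ₗ[ℂ] (Expo d → ℂ) where
  toFun a := formCoeffs d (∑ i, (∑ j, A i j • MvPolynomial.X j) *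
    MvPolynomial.pderiv i (formPoly a))
  map_add' a b := by
    simp only [formPoly_add, map_add, mul_add, Finset.sum_add_distrib]
  map_smul' r a := by
    rw [RingHom.id_apply, ← map_smul, Finset.smul_sum]
    simp only [formPoly_smul, Derivation.map_smul, mul_smul_comm]

theorem universalForm_derivForm {R : Type*} [CommRing R] [Algebra ℂ R] (hd : 1 ≤ d)
    (A : Matrix (Fin 4) (Fin 4) ℂ) (a : Expo d → ℂ) (w : Fin 4 → R) :
    universalForm (derivForm A a) w = ∑ i, MvPolynomial.aeval w
      (MvPolynomial.pderiv i (formPoly a)) * ∑ j, A i j • w j := by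
  have hP : (∑ i, (∑ j, A i j • MvPolynomial.X j) *
      MvPolynomial.pderiv i (formPoly a)).IsHomogeneous d := by
    refine MvPolynomial.IsHomogeneous.sum _ _ _ fun i _ => ?_
    have h1 : (∑ j, A i j • MvPolynomial.X j : MvPolynomial (Fin 4) ℂ).IsHomogeneous 1 := by
      refine MvPolynomial.IsHomogeneous.sum _ _ _ fun j _ => ?_
      rw [MvPolynomial.smul_eq_C_mul]
      exact MvPolynomial.isHomogeneous_C_mul_X _ _
    have h2 := h1.mul ((formPoly_isHomogeneous a).pderiv (i := i))
    rwa [Nat.add_sub_cancel' hd] at h2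
  rw [derivForm, LinearMap.coe_mk, AddHom.coe_mk, universalForm_formCoeffs hP]
  simp only [map_sum, map_mul, map_smul, MvPolynomial.aeval_X]
  exact Finset.sum_congr rfl fun i _ => mul_comm _ _

/-- The field of the infinitesimal linear transformation `A` of `ℂ⁴`, times `Z_i^12`. -/
def linearField (i : Fin 4) (A : Matrix (Fin 4) (Fin 4) ℂ) (x : JetCoords d) : JetCoords d :=
  x.1 0 i ^ 12 • (fun k l => ∑ j, A l j * x.1 k j, -derivForm A x.2.1, 0)

theorem coordSeries_matrix (A : Matrix (Fin 4) (Fin 4) ℂ) (z : Fin 4 → Fin 4 → ℂ) (l : Fin 4) :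
    coordSeries (fun k l => ∑ j, A l j * z k j) l = ∑ j, A l j • coordSeries z j := by
  simp only [coordSeries, toSeries, map_sum, Finset.smul_sum]
  rw [Finset.sum_comm]
  exact Finset.sum_congr rfl fun j _ => Finset.sum_congr rfl fun k _ => by
    rw [← map_smul, smul_eq_mul]

/-- The variations of `F_a(Z)` due to `Z` and to `a` cancel. A constant matrix commutes with
multiplication by `λ`, so the whole weight comes from `Z_i^12`. -/
theorem linearField_mem (hd : 1 ≤ d) (i : Fin 4) (A : Matrix (Fin 4) (Fin 4) ℂ) :
    (linearField i A : JetCoords d → JetCoords d) ∈ homogeneousFields d 12 0 where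
  analytic x := by
    refine ((analyticAt_coord 0 i).pow 12).smul (AnalyticAt.prod ?_ (AnalyticAt.prod ?_ ?_))
    · exact AnalyticAt.pi fun k => AnalyticAt.pi fun l =>
        Finset.analyticAt_fun_sum _ fun j _ => analyticAt_const.mul (analyticAt_coord k j)
    · have h : AnalyticAt ℂ (fun y : JetCoords d =>
          LinearMap.toContinuousLinearMap (derivForm (d := d) A) y.2.1) x :=
        ((LinearMap.toContinuousLinearMap (derivForm (d := d) A)).comp
          ((ContinuousLinearMap.fst ℂ _ _).comp (ContinuousLinearMap.snd ℂ _ _))).analyticAt x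
      exact h.neg
    · exact analyticAt_const
  tangent x := by
    rw [linearField, map_smul, fderiv_jetEquations_eq_zero _ rfl, smul_zero]
    rw [formAlongDeriv]
    simp only [coordSeries_matrix]
    rw [← universalForm_derivForm hd, ← neg_one_smul ℂ (derivForm A x.2.1), universalForm_smul]
    simpa using TruncEq.refl 4 0
  equivariant x lam mu _ _ := by
    rw [linearField, linearField, jetAct_coord_zero, jetActLinear_smul, smul_smul, pow_zero,
      mul_one, mul_pow]
    congr 1
    refine Prod.ext ?_ (Prod.ext ?_ ?_)
    · funext k l
      simp only [jetActLinear, coordSeries_matrix]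
      simp [jetAct, Finset.sum_mul]
    · simp [jetAct, jetActLinear]
    · simp [jetActLinear]

/-- The matrix of coefficients of the series `Z_i(t) Z_c(t)`. -/
def cramerMatrix (i : Fin 4) (x : JetCoords d) : Matrix (Fin 4) (Fin 4) ℂ :=
  coeffMatrix fun c => coordSeries x.1 c * coordSeries x.1 i

/-- The solution by Cramer's rule `L` of `∑ L_c Z_c Z_i = det · Z_a Z_b` modulo `t⁴`. -/
def cramerSolution (i a b : Fin 4) (x : JetCoords d) : Fin 4 → ℂ :=
  Matrix.vecMul (coeffRow (coordSeries x.1 a * coordSeries x.1 b)) (cramerMatrix i x).adjugate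

theorem cramerSolution_spec (i a b : Fin 4) (x : JetCoords d) :
    TruncEq 4 (∑ c, cramerSolution i a b x c • (coordSeries x.1 c * coordSeries x.1 i))
      ((cramerMatrix i x).det • (coordSeries x.1 a * coordSeries x.1 b)) := by
  apply truncEq_of_coeffRow
  rw [coeffRow_sum_smul, cramerSolution, Matrix.vecMul_vecMul]
  change Matrix.vecMul _ ((cramerMatrix i x).adjugate * cramerMatrix i x) = _
  rw [Matrix.adjugate_mul, Matrix.vecMul_smul, Matrix.vecMul_one]
  funext k
  simp [coeffRow]

theorem cramerMatrix_jetAct (i : Fin 4) (lam : PowerSeries ℂ) (mu : ℂ) (x : JetCoords d) :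
    cramerMatrix i (jetAct lam mu x) = cramerMatrix i x * shiftMatrix (lam * lam) := by
  rw [cramerMatrix, cramerMatrix, ← coeffMatrix_mul]
  refine coeffMatrix_congr fun c => ?_
  rw [mul_mul_mul_comm (coordSeries x.1 c)]
  exact (truncEq_coordSeries_jetAct x c).mul (truncEq_coordSeries_jetAct x i)

theorem det_cramerMatrix_jetAct (i : Fin 4) (lam : PowerSeries ℂ) (mu : ℂ) (x : JetCoords d) :
    (cramerMatrix i (jetAct lam mu x)).det =
      PowerSeries.constantCoeff lam ^ 8 * (cramerMatrix i x).det := by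
  rw [cramerMatrix_jetAct, Matrix.det_mul, det_shiftMatrix, map_mul]
  ring

/-- Both sides of the linear system are quadratic in `Z`, hence multiplied by `λ²`; the factor `Z_i`
is there for this. The solution therefore has the same weight as the determinant. -/
theorem cramerSolution_jetAct (i a b : Fin 4) (lam : PowerSeries ℂ) (mu : ℂ) (x : JetCoords d) :
    cramerSolution i a b (jetAct lam mu x) =
      PowerSeries.constantCoeff lam ^ 8 • cramerSolution i a b x := by
  have h : coeffRow (coordSeries (jetAct lam mu x).1 a * coordSeries (jetAct lam mu x).1 b) =
      Matrix.vecMul (coeffRow (coordSeries x.1 a * coordSeries x.1 b))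
        (shiftMatrix (lam * lam)) := by
    rw [← coeffRow_mul, mul_mul_mul_comm (coordSeries x.1 a)]
    exact coeffRow_congr ((truncEq_coordSeries_jetAct x a).mul (truncEq_coordSeries_jetAct x b))
  rw [cramerSolution, cramerMatrix_jetAct, Matrix.adjugate_mul_distrib, h, Matrix.vecMul_vecMul,
    ← Matrix.mul_assoc, Matrix.mul_adjugate, det_shiftMatrix, Matrix.smul_mul, Matrix.one_mul,
    Matrix.vecMul_smul, map_mul, cramerSolution]
  congr 1
  ring

/-- The field moving only the form `F_a`, in the direction of the form
`Q (det · X_a X_b - X_i ∑ L_c X_c)` that vanishes along the jet, times `Z_i^4 a_β`. -/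
def cramerField (i : Fin 4) (β : Expo d) (Q : MvPolynomial (Fin 4) ℂ) (a b : Fin 4)
    (x : JetCoords d) : JetCoords d :=
  (x.1 0 i ^ 4 * x.2.1 β) • (0,
    (cramerMatrix i x).det • formCoeffs d (Q * (MvPolynomial.X a * MvPolynomial.X b)) -
      ∑ c, cramerSolution i a b x c •
        formCoeffs d (Q * (MvPolynomial.X c * MvPolynomial.X i)), 0)

theorem analyticAt_cramerMatrix (i : Fin 4) (x : JetCoords d) (j k : Fin 4) :
    AnalyticAt ℂ (fun y : JetCoords d => cramerMatrix i y j k) x :=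
  ((seriesAnalyticAt_coordSeries j).mul (seriesAnalyticAt_coordSeries i)) k

/-- The weight is `8` from Cramer's rule plus `4` from `Z_i^4`. The direction in `a` does not depend
on `a`, so `a_β` supplies the factor `μ` by which such a vector must scale when `m = 0`. -/
theorem cramerField_mem {e : ℕ} (he : e + 2 = d) (i : Fin 4) (β : Expo d)
    {Q : MvPolynomial (Fin 4) ℂ} (hQ : Q.IsHomogeneous e) (a b : Fin 4) :
    cramerField i β Q a b ∈ homogeneousFields d 12 0 where
  analytic x := by
    refine (((analyticAt_coord 0 i).pow 4).mul (analyticAt_coeff β)).smul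
      (AnalyticAt.prod analyticAt_const (AnalyticAt.prod ?_ analyticAt_const))
    have hK := analyticAt_cramerMatrix i x
    refine ((analyticAt_det hK).smul analyticAt_const).sub
      (Finset.analyticAt_fun_sum _ fun c _ => AnalyticAt.fun_smul ?_ analyticAt_const)
    simp only [cramerSolution, Matrix.vecMul, dotProduct]
    exact Finset.analyticAt_fun_sum _ fun (p : Fin 4) _ =>
      (((seriesAnalyticAt_coordSeries a).mul (seriesAnalyticAt_coordSeries b)) (p : ℕ)).fun_mul
        (analyticAt_adjugate hK p c)
  tangent x := by
    have hX : ∀ p q : Fin 4, (Q * (MvPolynomial.X p * MvPolynomial.X q)).IsHomogeneous d :=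
      fun p q => he ▸ hQ.mul ((MvPolynomial.isHomogeneous_X ℂ p).mul
        (MvPolynomial.isHomogeneous_X ℂ q))
    rw [cramerField, map_smul, fderiv_jetEquations_eq_zero _ rfl, smul_zero]
    have h0 : ∀ l, coordSeries (0 : Fin 4 → Fin 4 → ℂ) l = 0 := fun l => by
      simpa using coordSeries_smul 0 (0 : Fin 4 → Fin 4 → ℂ) l
    simp only [formAlongDeriv, h0, mul_zero, Finset.sum_const_zero, add_zero]
    have h := (TruncEq.refl 4 (MvPolynomial.aeval (coordSeries x.1) Q)).mul
      ((TruncEq.refl 4 ((cramerMatrix i x).det • (coordSeries x.1 a * coordSeries x.1 b))).sub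
        (cramerSolution_spec i a b x))
    rw [sub_self, mul_zero] at h
    refine TruncEq.trans ?_ h
    simp only [← map_smul, ← map_sum]
    rw [← map_sub, universalForm_formCoeffs]
    · simp only [map_sub, map_sum, map_mul, map_smul, MvPolynomial.aeval_X, mul_sub,
        Finset.mul_sum, mul_smul_comm]
      exact TruncEq.refl _ _
    · refine MvPolynomial.IsHomogeneous.sub ?_ (MvPolynomial.IsHomogeneous.sum _ _ _ fun c _ => ?_)
      · rw [MvPolynomial.smul_eq_C_mul]; exact (hX _ _).C_mul _
      · rw [MvPolynomial.smul_eq_C_mul]; exact (hX _ _).C_mul _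
  equivariant x lam mu _ _ := by
    rw [cramerField, cramerField, jetAct_coord_zero, jetActLinear_smul, det_cramerMatrix_jetAct,
      cramerSolution_jetAct]
    refine Prod.ext ?_ (Prod.ext ?_ ?_)
    · funext k l
      have h0 : coordSeries (0 : Fin 4 → Fin 4 → ℂ) l = 0 := by
        simpa using coordSeries_smul 0 (0 : Fin 4 → Fin 4 → ℂ) l
      simp [jetActLinear, h0]
    · simp only [jetAct, jetActLinear, Prod.smul_fst, Prod.smul_snd, Pi.smul_apply, smul_eq_mul,
        mul_smul, ← Finset.smul_sum, smul_sub, pow_zero]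
      simp only [smul_smul]
      congr 1
      · congr 1; ring
      · congr 1; ring
    · simp [jetActLinear]

end Fields


/-! ### Generation at a nondegenerate jet -/

section Generation

variable {d : ℕ}

/-- The values at `x` of the homogeneous fields. -/
def homogeneousValues (d c m : ℕ) (x : JetCoords d) : Submodule ℂ (JetCoords d) :=
  (homogeneousFields d c m).map (LinearMap.proj x)

/-- The polynomials which vanish to third order along the jet and whose coefficients are the value
of a homogeneous field. -/
def attainedForms (x : JetCoords d) : Submodule ℂ (MvPolynomial (Fin 4) ℂ) :=
  ((homogeneousValues d 12 0 x).comap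
      (((LinearMap.inr ℂ (Fin 4 → Fin 4 → ℂ) ((Expo d → ℂ) × (Fin 3 → ℂ))).comp
        (LinearMap.inl ℂ (Expo d → ℂ) (Fin 3 → ℂ))).comp (formCoeffs d))) ⊓
    LinearMap.ker (LinearMap.pi fun k : Fin 4 => (PowerSeries.coeff (k : ℕ)).comp
      (MvPolynomial.aeval (R := ℂ) (coordSeries x.1)).toLinearMap)

theorem mem_attainedForms {x : JetCoords d} {P : MvPolynomial (Fin 4) ℂ} :
    P ∈ attainedForms x ↔ ((0, formCoeffs d P, 0) : JetCoords d) ∈ homogeneousValues d 12 0 x ∧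
      TruncEq 4 (MvPolynomial.aeval (coordSeries x.1) P) 0 := by
  rw [attainedForms, Submodule.mem_inf, Submodule.mem_comap, LinearMap.mem_ker]
  refine and_congr Iff.rfl ⟨fun h k hk => ?_, fun h => funext fun k => ?_⟩
  · simpa using congrFun h ⟨k, hk⟩
  · simpa using h k k.2

variable {i : Fin 4} {β : Expo d} {x : JetCoords d}

theorem cramer_mem_attainedForms (hi0 : x.1 0 i = 1)
    (hβ : x.2.1 β = 1) {e : ℕ} (he : e + 2 = d) {Q : MvPolynomial (Fin 4) ℂ}
    (hQ : Q.IsHomogeneous e) (a b : Fin 4) :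
    (cramerMatrix i x).det • (Q * (MvPolynomial.X a * MvPolynomial.X b)) -
      ∑ c, cramerSolution i a b x c • (Q * (MvPolynomial.X c * MvPolynomial.X i)) ∈
        attainedForms x := by
  rw [mem_attainedForms]
  constructor
  · refine ⟨_, cramerField_mem he i β hQ a b, ?_⟩
    simp only [LinearMap.proj_apply, cramerField, hi0, hβ, map_sub, map_sum, map_smul]
    simp
  · have h := (TruncEq.refl 4 (MvPolynomial.aeval (coordSeries x.1) Q)).mul
      ((TruncEq.refl 4 ((cramerMatrix i x).det • (coordSeries x.1 a * coordSeries x.1 b))).sub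
        (cramerSolution_spec i a b x))
    rw [sub_self, mul_zero] at h
    refine TruncEq.trans ?_ h
    simp only [map_sub, map_sum, map_mul, map_smul, MvPolynomial.aeval_X, mul_sub,
      Finset.mul_sum, mul_smul_comm]
    exact TruncEq.refl _ _

theorem eq_C_of_isHomogeneous_zero {P : MvPolynomial (Fin 4) ℂ} (hP : P.IsHomogeneous 0) :
    P = MvPolynomial.C (MvPolynomial.coeff 0 P) := by
  rw [← MvPolynomial.totalDegree_zero_iff_isHomogeneous] at hP
  exact MvPolynomial.totalDegree_eq_zero_iff_eq_C.mp hP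

theorem cramerMatrix_eq (hi : coordSeries x.1 i = 1) :
    cramerMatrix i x = coeffMatrix (coordSeries x.1) := by
  simp [cramerMatrix, hi]

/-- Modulo the attained forms, every form is a linear form times `X_i^(d-1)`. -/
theorem mem_attainedForms_sup (hi : coordSeries x.1 i = 1) (hi0 : x.1 0 i = 1)
    (hβ : x.2.1 β = 1) (hdet : (coeffMatrix (coordSeries x.1)).det ≠ 0) (n : ℕ) :
    ∀ e, e + n + 1 = d → ∀ R : MvPolynomial (Fin 4) ℂ, R.IsHomogeneous (n + 1) →
      MvPolynomial.X i ^ e * R ∈ attainedForms x ⊔ Submodule.span ℂ (Set.range fun c : Fin 4 =>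
        (MvPolynomial.X i ^ (d - 1) * MvPolynomial.X c : MvPolynomial (Fin 4) ℂ)) := by
  induction n with
  | zero =>
    intro e he R hR
    -- Euler's identity in degree one.
    have hR' : R = ∑ c, MvPolynomial.coeff 0 (MvPolynomial.pderiv c R) • MvPolynomial.X c := by
      conv_lhs => rw [← one_smul ℕ R, ← zero_add 1, ← hR.sum_X_mul_pderiv]
      refine Finset.sum_congr rfl fun c _ => ?_
      conv_lhs => rw [eq_C_of_isHomogeneous_zero (hR.pderiv (i := c))]
      rw [MvPolynomial.smul_eq_C_mul, mul_comm]
    rw [hR', Finset.mul_sum]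
    refine Submodule.sum_mem _ fun c _ => ?_
    rw [mul_smul_comm]
    refine Submodule.smul_mem _ _ (Submodule.mem_sup_right (Submodule.subset_span ⟨c, ?_⟩))
    simp [← he]
  | succ n ih =>
    intro e he R hR
    -- Euler's identity, used twice, writes a nonzero multiple of `R` as a sum of terms `X_a X_b S`
    -- with `S` of degree `n`. A Cramer form replaces `det · X_a X_b` by `X_i ∑ L_c X_c`, trading
    -- one degree of `R` for a factor `X_i`.
    have h1 : ((n + 1 + 1 : ℕ) : ℂ) • R = ∑ a, MvPolynomial.X a * MvPolynomial.pderiv a R := by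
      rw [hR.sum_X_mul_pderiv, Nat.cast_smul_eq_nsmul]
    have h2 : ∀ a, ((n + 1 : ℕ) : ℂ) • MvPolynomial.pderiv a R =
        ∑ b, MvPolynomial.X b * MvPolynomial.pderiv b (MvPolynomial.pderiv a R) := fun a => by
      have := hR.pderiv (i := a)
      rw [Nat.add_sub_cancel] at this
      rw [this.sum_X_mul_pderiv, Nat.cast_smul_eq_nsmul]
    have hn1 : ((n + 1 + 1 : ℕ) : ℂ) ≠ 0 := Nat.cast_ne_zero.mpr (by omega)
    have hn2 : ((n + 1 : ℕ) : ℂ) ≠ 0 := Nat.cast_ne_zero.mpr (by omega)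
    rw [← Submodule.smul_mem_iff _ hn1, ← mul_smul_comm, h1, Finset.mul_sum]
    refine Submodule.sum_mem _ fun a _ => ?_
    rw [← Submodule.smul_mem_iff _ hn2, ← mul_smul_comm, ← mul_smul_comm, h2, Finset.mul_sum,
      Finset.mul_sum]
    refine Submodule.sum_mem _ fun b _ => ?_
    set S := MvPolynomial.pderiv b (MvPolynomial.pderiv a R) with hS
    have hSh : S.IsHomogeneous n := by
      have h := (hR.pderiv (i := a)).pderiv (i := b)
      rwa [Nat.add_sub_cancel, Nat.add_sub_cancel] at h
    have hQ : (MvPolynomial.X i ^ e * S).IsHomogeneous (e + n) :=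
      (MvPolynomial.isHomogeneous_X_pow i e).mul hSh
    have hc := cramer_mem_attainedForms hi0 hβ (by omega : e + n + 2 = d) hQ a b
    have hL : (∑ c, cramerSolution i a b x c • MvPolynomial.X c :
        MvPolynomial (Fin 4) ℂ).IsHomogeneous 1 := by
      refine MvPolynomial.IsHomogeneous.sum _ _ _ fun c _ => ?_
      rw [MvPolynomial.smul_eq_C_mul]
      exact MvPolynomial.isHomogeneous_C_mul_X _ _
    have hl := ih (e + 1) (by omega) _ (hSh.mul hL)
    rw [← cramerMatrix_eq hi] at hdet
    rw [← Submodule.smul_mem_iff _ hdet]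
    have hsum := Submodule.add_mem _ (Submodule.mem_sup_left (T := Submodule.span ℂ
      (Set.range fun c : Fin 4 =>
        (MvPolynomial.X i ^ (d - 1) * MvPolynomial.X c : MvPolynomial (Fin 4) ℂ))) hc) hl
    convert hsum using 1
    rw [Finset.mul_sum, Finset.mul_sum, ← sub_eq_zero]
    simp only [mul_smul_comm]
    have hsc : ∀ c, MvPolynomial.X i ^ (e + 1) * (S * MvPolynomial.X c) =
        MvPolynomial.X i ^ e * S * (MvPolynomial.X c * MvPolynomial.X i) := fun c => by ring
    simp only [hsc]
    rw [sub_add_cancel, sub_eq_zero]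
    congr 1
    ring

/-- Every form vanishing to third order along a nondegenerate jet is attained. -/
theorem vanishing_mem_homogeneousValues (hd : 1 ≤ d) (hx : x ∈ jetChart d i β)
    (hdet : (coeffMatrix (coordSeries x.1)).det ≠ 0) {b : Expo d → ℂ}
    (hb : TruncEq 4 (universalForm b (coordSeries x.1)) 0) :
    ((0, b, 0) : JetCoords d) ∈ homogeneousValues d 12 0 x := by
  have hi := coordSeries_eq_one hx.2.1
  have hi0 : x.1 0 i = 1 := by simpa using hx.2.1 0
  obtain ⟨n, rfl⟩ : ∃ n, d = n + 1 := ⟨d - 1, by omega⟩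
  have h := mem_attainedForms_sup hi hi0 hx.2.2 hdet n 0 (by omega) _ (formPoly_isHomogeneous b)
  rw [pow_zero, one_mul, Submodule.mem_sup] at h
  obtain ⟨g, hg, l, hl, hgl⟩ := h
  obtain ⟨u, rfl⟩ := (Submodule.mem_span_range_iff_exists_fun ℂ).mp hl
  have hg' := mem_attainedForms.mp hg
  -- Both `F_b` and the attained part vanish modulo `t⁴` along the jet, hence so does the remainder,
  -- whose value is `∑ u_c Z_c` because `Z_i(t) = 1`.
  have h1 : TruncEq 4 (∑ c, u c • coordSeries x.1 c) 0 := by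
    have h2 := congrArg (MvPolynomial.aeval (coordSeries x.1)) hgl
    rw [aeval_formPoly, map_add] at h2
    have h3 := (hb.sub hg'.2)
    rw [← h2, add_sub_cancel_left, sub_zero] at h3
    refine TruncEq.trans ?_ h3
    simp only [map_sum, map_smul, map_mul, map_pow, MvPolynomial.aeval_X, hi, one_pow, one_mul]
    exact TruncEq.refl _ _
  have h0 : coeffRow 0 = 0 := by funext k; simp [coeffRow]
  have hu : u = 0 := by
    have h2 := coeffRow_congr h1
    rw [coeffRow_sum_smul, h0] at h2
    exact Matrix.eq_zero_of_vecMul_eq_zero hdet h2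
  have hg1 : g = formPoly b := by rw [← hgl, hu]; simp
  have := hg'.1
  rwa [hg1, formCoeffs_formPoly] at this

/-- The infinitesimal change of homogeneous coordinates `λ = 1 + r h`. -/
def gaugeVector (h : PowerSeries ℂ) (x : JetCoords d) : JetCoords d :=
  (fun k l => PowerSeries.coeff (k : ℕ) (coordSeries x.1 l * h), 0,
    fun k => d * PowerSeries.coeff (k : ℕ) (PowerSeries.derivative ℂ h))

theorem hasDerivAt_jetAct (h : PowerSeries ℂ) (x : JetCoords d) :
    HasDerivAt (fun r : ℂ => jetAct (1 + r • h) 1 x) (gaugeVector h x) 0 := by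
  have hl := SeriesHasDerivAt.line 1 h
  refine HasDerivAt.prodMk ?_ (HasDerivAt.prodMk ?_ ?_)
  · refine hasDerivAt_pi.mpr fun k => hasDerivAt_pi.mpr fun l => ?_
    have := ((SeriesHasDerivAt.const (coordSeries x.1 l)).mul hl) k
    rwa [zero_mul, zero_add] at this
  · exact hasDerivAt_const _ _
  · refine hasDerivAt_pi.mpr fun k => ?_
    have hline : SeriesAnalyticAt (fun r : ℂ => 1 + r • h) 0 := fun k => by
      simp only [map_add, map_smul, smul_eq_mul]
      fun_prop
    have hinv : SeriesAnalyticAt (fun r : ℂ => PowerSeries.derivative ℂ h * (1 + r • h)⁻¹) 0 :=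
      (SeriesAnalyticAt.const _).mul (hline.inv (by simp))
    have h1 := (hasDerivAt_id (0 : ℂ)).mul (hinv k).differentiableAt.hasDerivAt
    have h2 := (h1.const_mul (d : ℂ)).const_add (x.2.2 k)
    have hone : (1 : PowerSeries ℂ)⁻¹ = 1 := by
      have := PowerSeries.mul_inv_cancel (1 : PowerSeries ℂ) (by simp)
      rwa [one_mul] at this
    simp only [id, zero_smul, add_zero, one_mul, zero_mul, hone, mul_one] at h2
    convert h2 using 1
    funext r
    simp

/-- The vector is tangent to an orbit, on which the normalisation is constant. -/
theorem fderiv_toJetChart_gaugeVector (hi : x.1 0 i ≠ 0) (hβ : x.2.1 β ≠ 0)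
    (h : PowerSeries ℂ) : fderiv ℂ (toJetChart d i β) x (gaugeVector h x) = 0 := by
  have hone : (1 : PowerSeries ℂ)⁻¹ = 1 := by
    have := PowerSeries.mul_inv_cancel (1 : PowerSeries ℂ) (by simp)
    rwa [one_mul] at this
  have hx0 : jetAct (1 + (0 : ℂ) • h) 1 x = x := by
    refine Prod.ext ?_ (Prod.ext ?_ ?_)
    · funext k l
      simp [jetAct, coeff_coordSeries]
    · simp [jetAct]
    · funext k
      simp [jetAct]
  have hT : HasFDerivAt (toJetChart d i β) (fderiv ℂ (toJetChart d i β) x)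
      (jetAct (1 + (0 : ℂ) • h) 1 x) := by
    rw [hx0]
    exact (analyticAt_toJetChart hi hβ).differentiableAt.hasFDerivAt
  have h1 := hT.comp_hasDerivAt (0 : ℂ) (hasDerivAt_jetAct h x)
  have hc : Continuous fun r : ℂ => PowerSeries.constantCoeff (1 + r • h) := by
    simp only [map_add, ← PowerSeries.coeff_zero_eq_constantCoeff_apply, map_smul, smul_eq_mul]
    fun_prop
  have hev : ∀ᶠ r : ℂ in 𝓝 0, PowerSeries.constantCoeff (1 + r • h) ≠ 0 :=
    hc.continuousAt.eventually_ne (by simp)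
  refine h1.unique ((hasDerivAt_const (0 : ℂ) (toJetChart d i β x)).congr_of_eventuallyEq ?_)
  filter_upwards [hev] with r hr
  exact toJetChart_jetAct hi hr one_ne_zero

/-- The line `x + r v` stays normalised, and the normalisation is the identity there. -/
theorem fderiv_toJetChart_of_mem (hx : x ∈ jetChart d i β) {v : JetCoords d}
    (hv : v ∈ jetTangentSpace d i β x) : fderiv ℂ (toJetChart d i β) x v = v := by
  have hi0 : x.1 0 i ≠ 0 := by simp [hx.2.1]
  have hβ0 : x.2.1 β ≠ 0 := by simp [hx.2.2]
  refine fderiv_apply_eq_of_hasDerivAt (analyticAt_toJetChart hi0 hβ0).differentiableAt ?_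
  have h : (fun r : ℂ => toJetChart d i β (x + r • v)) = fun r => x + r • v := by
    funext r
    refine toJetChart_eq_self (fun k => ?_) ?_
    · simp [hx.2.1 k, hv.1 k]
    · simp [hx.2.2, hv.2.1]
  rw [h]
  simpa using ((hasDerivAt_id (0 : ℂ)).smul_const v).const_add x

/-- Euler's identity for `F_a`, applied to the displacement `h Z`. -/
theorem formAlongDeriv_gaugeVector (h : PowerSeries ℂ) (x : JetCoords d) :
    TruncEq 4 (formAlongDeriv x (gaugeVector h x)) (PowerSeries.C (d : ℂ) * formAlong x * h) := by
  have hE := congrArg (MvPolynomial.aeval (coordSeries x.1))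
    (formPoly_isHomogeneous x.2.1).sum_X_mul_pderiv
  rw [map_nsmul, aeval_formPoly, map_sum] at hE
  have h1 : TruncEq 4 (formAlongDeriv x (gaugeVector h x)) (0 + ∑ l,
      MvPolynomial.aeval (coordSeries x.1) (MvPolynomial.pderiv l (formPoly x.2.1)) *
        (coordSeries x.1 l * h)) := by
    rw [formAlongDeriv, show (gaugeVector h x).2.1 = 0 from rfl, universalForm_zero]
    exact (TruncEq.refl _ _).add (TruncEq.sum fun l _ => (TruncEq.refl _ _).mul
      (truncEq_coordSeries (fun l => coordSeries x.1 l * h) l))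
  refine h1.trans ?_
  have h2 : (0 + ∑ l,
      MvPolynomial.aeval (coordSeries x.1) (MvPolynomial.pderiv l (formPoly x.2.1)) *
        (coordSeries x.1 l * h)) = PowerSeries.C (d : ℂ) * formAlong x * h := by
    rw [formAlong, map_natCast, ← nsmul_eq_mul, ← hE, zero_add, Finset.sum_mul]
    refine Finset.sum_congr rfl fun l _ => ?_
    rw [map_mul, MvPolynomial.aeval_X]
    ring
  rw [h2]
  exact TruncEq.refl _ _

/-- The tangent space at a nondegenerate jet off the surface is generated. -/
theorem exists_homogeneousField (hd : 1 ≤ d) (hx : x ∈ jetChart d i β)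
    (hdet : (coeffMatrix (coordSeries x.1)).det ≠ 0)
    (hs : PowerSeries.constantCoeff (formAlong x) ≠ 0) {v : JetCoords d}
    (hv : v ∈ jetTangentSpace d i β x) :
    ∃ V, IsHomogeneousField d 12 0 V ∧ fderiv ℂ (toJetChart d i β) x (V x) = v := by
  have hi0 : x.1 0 i = 1 := by simpa using hx.2.1 0
  have hd0 : (d : ℂ) ≠ 0 := Nat.cast_ne_zero.mpr (by omega)
  set s := formAlong x with hsdef
  set g := formAlongDeriv x v * s⁻¹ with hg
  have hgs : formAlongDeriv x v = g * s := by
    rw [hg, mul_assoc, PowerSeries.inv_mul_cancel _ hs, mul_one]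
  have hcone : TruncEq 3 (PowerSeries.derivative ℂ s) (toSeries x.2.2 * s) := fun k hk => by
    have h := congrFun hx.1.2.2 ⟨k, hk⟩
    rw [← sub_eq_zero, ← map_sub]
    exact h
  -- Here `g` is the variation of `log s`. The linearised equation `(g s)' ≡ v_η s + η g s`, where
  -- `v_η` is the `η`-part of `v`, and `s' ≡ η s` leave `g' s ≡ v_η s`.
  have hgd : TruncEq 3 (PowerSeries.derivative ℂ g) (toSeries v.2.2) := by
    refine TruncEq.cancel_left hs fun k hk => ?_
    have h := congrFun hv.2.2 ⟨k, hk⟩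
    rw [fderiv_jetEquations, hgs, Derivation.leibniz, smul_eq_mul, smul_eq_mul, Pi.zero_apply] at h
    have h' := ((TruncEq.refl 3 g).mul hcone) k hk
    simp only [map_sub, map_add] at h
    rw [h', show toSeries x.2.2 * (g * s) = g * (toSeries x.2.2 * s) by ring] at h
    rw [mul_comm s (toSeries v.2.2)]
    linear_combination h
  -- The gauge direction of `h` adds `d h'` to `η` and `d h s` to the variation of `s`; `h = -g/d`
  -- cancels both parts of `v`.
  set h : PowerSeries ℂ := PowerSeries.C (-(d : ℂ)⁻¹) * g with hh
  set V₀ : JetCoords d := v + gaugeVector h x with hV₀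
  have hV₀log : V₀.2.2 = 0 := by
    funext k
    have h1 := hgd k k.2
    rw [coeff_toSeries] at h1
    simp only [hV₀, gaugeVector, Prod.snd_add, Pi.add_apply, hh, Derivation.leibniz, smul_eq_mul,
      PowerSeries.derivative_C, mul_zero, add_zero, PowerSeries.coeff_C_mul, h1, Pi.zero_apply]
    field_simp
    ring
  have hV₀form : TruncEq 4 (formAlongDeriv x V₀) 0 := by
    have h1 := (TruncEq.refl 4 (formAlongDeriv x v)).add (formAlongDeriv_gaugeVector h x)
    rw [← formAlongDeriv_add] at h1
    refine h1.trans ?_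
    have h2 : PowerSeries.C (d : ℂ) * PowerSeries.C (-(d : ℂ)⁻¹) = -1 := by
      rw [← map_mul, mul_neg, mul_inv_cancel₀ hd0, map_neg, map_one]
    have h3 : formAlongDeriv x v + PowerSeries.C (d : ℂ) * formAlong x * h = 0 := by
      rw [hgs, hh, ← hsdef]
      linear_combination (s * g) * h2
    rw [h3]
    exact TruncEq.refl _ _
  set M := coeffMatrix (coordSeries x.1) with hM
  set A : Matrix (Fin 4) (Fin 4) ℂ := (Matrix.of fun l k => V₀.1 k l) * M⁻¹ with hA
  have hAM : (fun k l => ∑ j, A l j * x.1 k j) = V₀.1 := by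
    have h1 : A * M = Matrix.of fun l k => V₀.1 k l := by
      rw [hA, Matrix.mul_assoc, Matrix.nonsing_inv_mul _ (isUnit_iff_ne_zero.mpr hdet),
        Matrix.mul_one]
    funext k l
    have h2 := congrFun (congrFun h1 l) k
    rw [Matrix.mul_apply] at h2
    rw [Matrix.of_apply] at h2
    rw [← h2]
    refine Finset.sum_congr rfl fun j _ => ?_
    rw [hM, coeffMatrix, Matrix.of_apply, coeff_coordSeries]
  have hlin : ((V₀.1, -derivForm A x.2.1, 0) : JetCoords d) ∈ homogeneousValues d 12 0 x := by
    refine ⟨_, linearField_mem hd i A, ?_⟩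
    rw [LinearMap.proj_apply, linearField, hi0, one_pow, one_smul, hAM]
  -- Neither `V₀` nor the linear field changes `s` modulo `t⁴`, and their `Z`-parts agree; so the
  -- form in their difference vanishes along the jet.
  have hker : ((0, V₀.2.1 + derivForm A x.2.1, 0) : JetCoords d) ∈
      homogeneousValues d 12 0 x := by
    refine vanishing_mem_homogeneousValues hd hx hdet ?_
    rw [universalForm_add, universalForm_derivForm hd]
    refine TruncEq.trans ?_ hV₀form
    rw [formAlongDeriv]
    simp only [← coordSeries_matrix, hAM]
    exact TruncEq.refl _ _
  obtain ⟨V, hV, hVx⟩ := Submodule.add_mem _ hlin hker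
  refine ⟨V, hV, ?_⟩
  have hVx' : V x = V₀ := by
    rw [← LinearMap.proj_apply (R := ℂ) (φ := fun _ => JetCoords d) x V, hVx]
    refine Prod.ext ?_ (Prod.ext ?_ ?_)
    · simp
    · simp
    · simp [hV₀log]
  rw [hVx', hV₀, map_add, fderiv_toJetChart_of_mem hx hv,
    fderiv_toJetChart_gaugeVector (by simp [hi0]) (by simp [hx.2.2]), add_zero]

end Generation


/-! ### Degenerate jets and the covering -/

section Covering

variable {d : ℕ}

/-- Newton's method: adding `c t^(n+1)` to `r` changes the coefficient of `t^(n+1)` in `r^d` by `d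
r(0)^(d-1) c`, and this factor is invertible. -/
theorem exists_truncEq_pow (hd : 1 ≤ d) {s : PowerSeries ℂ}
    (hs : PowerSeries.constantCoeff s ≠ 0) (n : ℕ) :
    ∃ r : PowerSeries ℂ, PowerSeries.constantCoeff r ≠ 0 ∧ TruncEq (n + 1) (r ^ d) s := by
  induction n with
  | zero =>
    obtain ⟨c, hc⟩ := IsAlgClosed.exists_pow_nat_eq (PowerSeries.constantCoeff s) hd
    refine ⟨PowerSeries.C c, ?_, fun k hk => ?_⟩
    · rw [PowerSeries.constantCoeff_C]
      rintro rfl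
      rw [zero_pow (by omega)] at hc
      exact hs hc.symm
    · obtain rfl : k = 0 := by omega
      simp [hc]
  | succ n ih =>
    obtain ⟨r, hr, h⟩ := ih
    have hd0 : (d : ℂ) ≠ 0 := Nat.cast_ne_zero.mpr (by omega)
    have hu : (d : ℂ) * PowerSeries.constantCoeff r ^ (d - 1) ≠ 0 :=
      mul_ne_zero hd0 (pow_ne_zero _ hr)
    set c : ℂ := (PowerSeries.coeff (n + 1) s - PowerSeries.coeff (n + 1) (r ^ d)) /
      ((d : ℂ) * PowerSeries.constantCoeff r ^ (d - 1)) with hc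
    obtain ⟨q, hq⟩ := Polynomial.powAddExpansion r (PowerSeries.C c * PowerSeries.X ^ (n + 1)) d
    have hq' : (r + PowerSeries.C c * PowerSeries.X ^ (n + 1)) ^ d = r ^ d +
        PowerSeries.X ^ (n + 1) * (PowerSeries.C ((d : ℂ) * c) * r ^ (d - 1)) +
        PowerSeries.X ^ (n + 1 + 1) * (q * PowerSeries.C c ^ 2 * PowerSeries.X ^ n) := by
      rw [hq, map_mul, map_natCast]
      ring
    refine ⟨r + PowerSeries.C c * PowerSeries.X ^ (n + 1), by simpa using hr, fun k hk => ?_⟩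
    rw [hq', map_add, map_add, PowerSeries.coeff_X_pow_mul', PowerSeries.coeff_X_pow_mul',
      if_neg (by omega : ¬ n + 1 + 1 ≤ k), add_zero]
    by_cases hkn : n + 1 ≤ k
    · obtain rfl : k = n + 1 := by omega
      rw [if_pos le_rfl, Nat.sub_self, PowerSeries.coeff_zero_eq_constantCoeff_apply, map_mul,
        PowerSeries.constantCoeff_C, map_pow PowerSeries.constantCoeff]
      have : (d : ℂ) * PowerSeries.constantCoeff r ^ (d - 1) * c =
          PowerSeries.coeff (n + 1) s - PowerSeries.coeff (n + 1) (r ^ d) := mul_div_cancel₀ _ hu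
      linear_combination this
    · rw [if_neg hkn, add_zero, h k (by omega)]

/-- The point of the covering with coordinates `Z`, `Z₄ = ρ`, `a`, `a_d = 1` and `ζ = η / d`. -/
def coverPoint (z : Fin 4 → Fin 4 → ℂ) (ρ : PowerSeries ℂ) (a : Expo d → ℂ) (η : Fin 3 → ℂ) :
    CoverCoords d :=
  (fun k => Fin.snoc (α := fun _ => ℂ) (z k) (PowerSeries.coeff (k : ℕ) ρ), (a, 1),
    fun k => (d : ℂ)⁻¹ * η k)

variable {z : Fin 4 → Fin 4 → ℂ} {ρ : PowerSeries ℂ} {a : Expo d → ℂ} {η : Fin 3 → ℂ}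

theorem coordSeries_coverPoint_castSucc (l : Fin 4) :
    coordSeries (coverPoint z ρ a η).1 l.castSucc = coordSeries z l := by
  simp [coordSeries, coverPoint]

theorem truncEq_coordSeries_coverPoint :
    TruncEq 4 (coordSeries (coverPoint z ρ a η).1 4) ρ := by
  have h : coordSeries (coverPoint z ρ a η).1 4 =
      toSeries fun k : Fin 4 => PowerSeries.coeff (k : ℕ) ρ :=
    congrArg toSeries (funext fun k =>
      Fin.snoc_last (n := 4) (α := fun _ => ℂ) (PowerSeries.coeff (k : ℕ) ρ) (z k))
  rw [h]
  exact truncEq_toSeries ρ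

theorem piThree_coverPoint (hd : 1 ≤ d) : piThree d (coverPoint z ρ a η) = (z, a, η) := by
  have hd0 : (d : ℂ) ≠ 0 := Nat.cast_ne_zero.mpr (by omega)
  simp [piThree, coverPoint, mul_inv_cancel_left₀ hd0]

/-- From `ρ^d ≡ -s` and `s' ≡ η s` follows `d ρ^(d-1) ρ' ≡ η ρ^d`; cancelling the unit `d ρ^(d-1)`
shows that `η / d` is the logarithmic derivative of `ρ`. -/
theorem coverPoint_mem_coverCone (hd : 1 ≤ d) {s : PowerSeries ℂ} (hz : z 0 ≠ 0) (ha : a ≠ 0)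
    (hs : universalForm a (coordSeries z) = s)
    (hη : TruncEq 3 (PowerSeries.derivative ℂ s) (toSeries η * s))
    (hρ : PowerSeries.constantCoeff ρ ≠ 0) (hρs : TruncEq 4 (ρ ^ d) (-s)) :
    coverPoint z ρ a η ∈ coverCone d := by
  have hd0 : (d : ℂ) ≠ 0 := Nat.cast_ne_zero.mpr (by omega)
  refine ⟨fun h => hz ?_, ha, one_ne_zero, fun k => ?_, ?_⟩
  · funext l
    have := congrFun h l.castSucc
    simpa [coverPoint] using this
  · have h1 := ((truncEq_coordSeries_coverPoint (z := z) (ρ := ρ) (a := a) (η := η)).pow d).trans hρs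
    simp only [coordSeries_coverPoint_castSucc]
    rw [show (coverPoint z ρ a η).2.1 = (a, 1) from rfl]
    simp only [map_one, one_mul, map_add]
    rw [h1 k k.2, hs, map_neg, neg_add_cancel]
  · have hζ : TruncEq 3 (toSeries η) (PowerSeries.C (d : ℂ) *
        toSeries (coverPoint z ρ a η).2.2) := fun k hk => by
      have h1 := coeff_toSeries η ⟨k, hk⟩
      have h2 := coeff_toSeries (coverPoint z ρ a η).2.2 ⟨k, hk⟩
      simp only at h1 h2
      rw [PowerSeries.coeff_C_mul, h1, h2]
      simp [coverPoint, mul_inv_cancel_left₀ hd0]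
    have hpow : ρ ^ (d - 1) * ρ = ρ ^ d := by rw [← pow_succ, Nat.sub_add_cancel hd]
    have h1 : TruncEq 3 (PowerSeries.C (d : ℂ) * ρ ^ (d - 1) * PowerSeries.derivative ℂ ρ)
        (PowerSeries.C (d : ℂ) * ρ ^ (d - 1) * (toSeries (coverPoint z ρ a η).2.2 * ρ)) := by
      have h2 := hρs.derivative
      rw [PowerSeries.derivative_pow, map_neg] at h2
      have h3 := (TruncEq.refl 3 0).sub hη
      rw [zero_sub, zero_sub] at h3
      have h4 := hζ.mul (hρs.symm.mono (by norm_num : 3 ≤ 4))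
      rw [mul_neg] at h4
      have h5 := (h2.trans h3).trans h4
      rw [map_natCast]
      rw [map_natCast, ← hpow] at h5
      convert h5 using 1
      ring
    have hu : PowerSeries.constantCoeff (PowerSeries.C (d : ℂ) * ρ ^ (d - 1)) ≠ 0 := by
      rw [map_mul, map_pow, PowerSeries.constantCoeff_C]
      exact mul_ne_zero hd0 (pow_ne_zero _ hρ)
    have h6 := TruncEq.cancel_left hu h1
    have h7 := truncEq_coordSeries_coverPoint (z := z) (ρ := ρ) (a := a) (η := η)
    funext k
    have h8 := (h7.derivative.trans h6).sub
      ((TruncEq.refl 3 (toSeries (coverPoint z ρ a η).2.2)).mul (h7.mono (by norm_num : 3 ≤ 4)))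
    rw [sub_self] at h8
    simpa [logDefect] using h8 k k.2

theorem coverPoint_mem_wronskianLocus (hy : coverPoint z ρ a η ∈ coverCone d) (hz : z 0 0 ≠ 0)
    (hdet : (coeffMatrix (coordSeries z)).det = 0) :
    coverPoint z ρ a η ∈ wronskianLocus d := by
  refine ⟨hy, by simpa [coverPoint] using hz, ?_⟩
  obtain ⟨c, hc, hcM⟩ := Matrix.exists_vecMul_eq_zero_iff.mpr hdet
  have hz0 : PowerSeries.constantCoeff (coordSeries z 0) ≠ 0 := by
    rwa [constantCoeff_coordSeries]
  have h0 : coeffRow 0 = 0 := by funext k; simp [coeffRow]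
  -- A constant linear relation among the `Z_l` persists after division by `Z₀`. There the term `l =
  -- 0` is constant, so in orders one to three a relation among the rows of the Wronskian matrix
  -- remains; order zero shows that it is nontrivial.
  have h1 : TruncEq 4 (∑ l, c l • (coordSeries z l * (coordSeries z 0)⁻¹)) 0 := by
    have h2 : TruncEq 4 (∑ l, c l • coordSeries z l) 0 := by
      apply truncEq_of_coeffRow
      rw [coeffRow_sum_smul, hcM, h0]
    have h3 := h2.mul (TruncEq.refl 4 (coordSeries z 0)⁻¹)
    rw [Finset.sum_mul, zero_mul] at h3
    simpa only [smul_mul_assoc] using h3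
  rw [Fin.sum_univ_succ, PowerSeries.mul_inv_cancel _ hz0] at h1
  rw [← Matrix.exists_vecMul_eq_zero_iff]
  refine ⟨fun j => c j.succ, fun hcs => hc ?_, ?_⟩
  · have hcs' : ∀ j : Fin 3, c j.succ = 0 := fun j => congrFun hcs j
    have h2 := h1 0 (by norm_num)
    simp only [hcs', zero_smul, Finset.sum_const_zero, add_zero, map_smul] at h2
    funext l
    refine Fin.cases ?_ hcs' l
    simpa using h2
  · funext j
    have h2 := h1 ((j : ℕ) + 1) (by omega)
    rw [map_add, map_smul, PowerSeries.coeff_one, if_neg (by omega), smul_zero, zero_add,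
      map_sum, map_zero] at h2
    have hz' : coordSeries (coverPoint z ρ a η).1 0 = coordSeries z 0 :=
      coordSeries_coverPoint_castSucc 0
    simp only [Matrix.vecMul, dotProduct, Matrix.of_apply, affineDeriv, Fin.succ_castSucc,
      coordSeries_coverPoint_castSucc, hz', Pi.zero_apply]
    rw [← mul_zero ((((j : ℕ) + 1).factorial : ℂ)), ← h2, Finset.mul_sum]
    refine Finset.sum_congr rfl fun l _ => ?_
    rw [map_smul, smul_eq_mul]
    ring

/-! ### Shearing jets away from `{Z₀ = 0}`. -/

theorem continuous_coeff_aeval {w : ℂ → Fin 4 → MvPolynomial (Fin 4) ℂ}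
    (hw : ∀ l n, Continuous fun r => MvPolynomial.coeff n (w r l)) (P : MvPolynomial (Fin 4) ℂ) :
    ∀ n, Continuous fun r => MvPolynomial.coeff n (MvPolynomial.aeval (w r) P) := by
  induction P using MvPolynomial.induction_on with
  | C c => intro n; simpa using continuous_const
  | add p q hp hq =>
    intro n
    simp only [map_add, MvPolynomial.coeff_add]
    exact (hp n).add (hq n)
  | mul_X p l hp =>
    intro n
    simp only [map_mul, MvPolynomial.aeval_X, MvPolynomial.coeff_mul]
    exact continuous_finsetSum _ fun m _ => (hp m.1).mul (hw l m.2)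

/-- The jet with `Z₀` replaced by `Z₀ + r Z_i`. -/
def shearJet (i : Fin 4) (z : Fin 4 → Fin 4 → ℂ) (r : ℂ) : Fin 4 → Fin 4 → ℂ :=
  fun k l => z k l + if l = 0 then r * z k i else 0

/-- The substitution inverse to `shearJet`. -/
def shearSubst (i : Fin 4) (r : ℂ) (l : Fin 4) : MvPolynomial (Fin 4) ℂ :=
  MvPolynomial.X l - if l = 0 then MvPolynomial.C r * MvPolynomial.X i else 0

/-- The coefficients of the form whose value along `shearJet` is that of `F_a` along the jet. -/
def shearForm (i : Fin 4) (a : Expo d → ℂ) (r : ℂ) : Expo d → ℂ :=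
  formCoeffs d (MvPolynomial.aeval (shearSubst i r) (formPoly a))

theorem coordSeries_shearJet (i : Fin 4) (z : Fin 4 → Fin 4 → ℂ) (r : ℂ) (l : Fin 4) :
    coordSeries (shearJet i z r) l =
      coordSeries z l + if l = 0 then r • coordSeries z i else 0 := by
  by_cases hl : l = 0
  · simp only [coordSeries, shearJet, hl, if_true, ← toSeries_smul, ← toSeries_add]
    rfl
  · simp [coordSeries, shearJet, hl]

theorem universalForm_shearForm {i : Fin 4} (hi : i ≠ 0) (a : Expo d → ℂ)
    (z : Fin 4 → Fin 4 → ℂ) (r : ℂ) :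
    universalForm (shearForm i a r) (coordSeries (shearJet i z r)) =
      universalForm a (coordSeries z) := by
  have hP : (MvPolynomial.aeval (shearSubst i r) (formPoly a)).IsHomogeneous d := by
    have h := (formPoly_isHomogeneous a).aeval (shearSubst i r) (n := 1) fun l => by
      refine (MvPolynomial.isHomogeneous_X _ _).sub ?_
      split_ifs
      · exact MvPolynomial.isHomogeneous_C_mul_X _ _
      · exact MvPolynomial.isHomogeneous_zero _ _ _
    rwa [one_mul] at h
  rw [shearForm, universalForm_formCoeffs hP, ← aeval_formPoly a]
  rw [MvPolynomial.comp_aeval_apply]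
  congr 2
  funext l
  by_cases hl : l = 0
  · simp only [shearSubst, hl, if_true, map_sub, map_mul, MvPolynomial.aeval_X,
      coordSeries_shearJet, if_neg hi, add_zero, MvPolynomial.aeval_C]
    rw [← Algebra.smul_def, add_sub_cancel_right]
  · simp [shearSubst, hl, coordSeries_shearJet]

/-- The shear is an elementary row operation. -/
theorem det_coeffMatrix_shearJet {i : Fin 4} (hi : i ≠ 0) (z : Fin 4 → Fin 4 → ℂ) (r : ℂ) :
    (coeffMatrix (coordSeries (shearJet i z r))).det = (coeffMatrix (coordSeries z)).det := by
  rw [← Matrix.det_updateRow_add_smul_self (coeffMatrix (coordSeries z)) hi.symm r]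
  congr 1
  ext l k
  rw [Matrix.updateRow_apply]
  by_cases hl : l = 0
  · simp [coeffMatrix, coordSeries_shearJet, hl]
  · simp [coeffMatrix, coordSeries_shearJet, hl]

theorem continuous_shearForm (i : Fin 4) (a : Expo d → ℂ) : Continuous (shearForm i a) := by
  refine continuous_pi fun α => continuous_coeff_aeval (fun l n => ?_) _ _
  by_cases hl : l = 0
  · simp only [shearSubst, hl, if_true, MvPolynomial.coeff_sub, MvPolynomial.coeff_C_mul]
    fun_prop
  · simpa [shearSubst, hl] using continuous_const

theorem shearForm_zero (i : Fin 4) (a : Expo d → ℂ) : shearForm i a 0 = a := by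
  have h : shearSubst i 0 = MvPolynomial.X := by
    funext l; simp [shearSubst]
  rw [shearForm, h, MvPolynomial.aeval_X_left, AlgHom.id_apply, formCoeffs_formPoly]

/-- A degenerate jet off the surface lies in the image of `Σ`. -/
theorem mem_piThree_sigmaLocus (hd : 1 ≤ d) {x : JetCoords d} (hx : x ∈ jetCone d)
    (hs : PowerSeries.constantCoeff (formAlong x) ≠ 0)
    (hdet : (coeffMatrix (coordSeries x.1)).det = 0) :
    x ∈ piThree d '' sigmaLocus d := by
  obtain ⟨z, a, η⟩ := x
  obtain ⟨hz, ha, hE⟩ := hx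
  set s := formAlong (z, a, η) with hsdef
  have hη : TruncEq 3 (PowerSeries.derivative ℂ s) (toSeries η * s) := fun k hk => by
    have h := congrFun hE ⟨k, hk⟩
    rw [← sub_eq_zero, ← map_sub]
    exact h
  obtain ⟨ρ, hρ, hρs⟩ := exists_truncEq_pow hd
    (s := -s) (by rw [map_neg]; exact neg_ne_zero.mpr hs) 3
  have hmem := coverPoint_mem_coverCone hd hz ha rfl hη hρ hρs
  refine ⟨coverPoint z ρ a η, ⟨?_, hmem⟩, piThree_coverPoint hd⟩
  by_cases hz0 : z 0 0 = 0
  -- The shear gives `Z₀(0) = r Z_i(0) ≠ 0` for `r ≠ 0`. With the form moved along, `s` is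
  -- unchanged, so the same `η` and `ρ` serve, and the determinant stays zero. Letting `r → 0`
  -- places the lift in the closure.
  · obtain ⟨i, hi⟩ := Function.ne_iff.mp hz
    have hi0 : i ≠ 0 := by
      rintro rfl
      exact hi hz0
    have hev : ∀ᶠ r : ℂ in 𝓝[≠] 0,
        coverPoint (shearJet i z r) ρ (shearForm i a r) η ∈ wronskianLocus d := by
      filter_upwards [self_mem_nhdsWithin] with r hr
      have hzr : shearJet i z r 0 0 ≠ 0 := by
        simpa [shearJet, hz0] using And.intro hr hi
      have hsr := universalForm_shearForm hi0 a z r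
      refine coverPoint_mem_wronskianLocus
        (coverPoint_mem_coverCone hd (fun h => hzr (congrFun h 0)) (fun h => ?_) hsr hη hρ hρs)
        hzr (by rwa [det_coeffMatrix_shearJet hi0])
      rw [h, universalForm_zero] at hsr
      apply hs
      rw [hsdef, formAlong, ← hsr, map_zero]
    have hc : Continuous fun r : ℂ =>
        (coverPoint (shearJet i z r) ρ (shearForm i a r) η : CoverCoords d) := by
      refine Continuous.prodMk ?_ (Continuous.prodMk
        (Continuous.prodMk (continuous_shearForm i a) continuous_const) continuous_const)
      refine continuous_pi fun k => continuous_pi fun l => ?_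
      refine Fin.lastCases ?_ (fun l => ?_) l
      · simp only [Fin.snoc_last]
        exact continuous_const
      · simp only [Fin.snoc_castSucc, shearJet]
        split_ifs <;> fun_prop
    have hlim := (hc.tendsto 0).mono_left (nhdsWithin_le_nhds (s := {0}ᶜ))
    have hz00 : shearJet i z 0 = z := by
      funext k l; simp [shearJet]
    rw [shearForm_zero, hz00] at hlim
    exact mem_closure_of_tendsto hlim hev
  · exact subset_closure (coverPoint_mem_wronskianLocus hmem hz0 hdet)

end Covering

end

theorem corollary4 (d : ℕ) (hd : 1 ≤ d) :
    ∃ m : ℕ, ∀ (i : Fin 4) (β : Expo d), ∀ x ∈ jetChart d i β,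
      x ∉ piThree d '' sigmaLocus d ∪ overSurface d →
        ∀ v ∈ jetTangentSpace d i β x, ∃ s : TwistedJetField d 12 m, s.field i β x = v := by
  -- All the fields used have weight zero in `μ`, so no pole along `ℙ^{N_d}` is needed.
  refine ⟨0, fun i β x hx hxn v hv => ?_⟩
  rw [Set.mem_union, not_or] at hxn
  have hs : PowerSeries.constantCoeff (formAlong x) ≠ 0 := fun h => hxn.2 (by
    rw [formAlong, constantCoeff_universalForm] at h
    simp only [constantCoeff_coordSeries] at h
    exact h)
  obtain ⟨V, hV, hVx⟩ := exists_homogeneousField hd hx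
    (fun hdet => hxn.1 (mem_piThree_sigmaLocus hd hx.1 hs hdet)) hs hv
  exact ⟨hV.toTwisted, hVx⟩
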